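/- All Hilbert spaces are finite-dimensional; a channel is a completely positive trace-preserving superoperator. Fix input and output spaces, a noise level $\epsilon\in(0,1]$ and a state $\rho_0$ on the output space. For a family of channels $\{\mathcal U_\theta\}$ put $$\mathcal E_\theta(\rho)=\epsilon\,\rho_0+(1-\epsilon)\,\mathcal U_\theta(\rho).$$ (The case $\mathcal U_\theta(\rho)=U_\theta\rho U_\theta^\dagger$ with $U_\theta$ unitary is included.) **1. Programmability.** Let $\{\mathcal U_\theta\}_{\theta\in\Theta}$ be any family of channels, with an arbitrary index set $\Theta$. Then $\{\mathcal E_\theta\}$ is programmable: there are a finite-dimensional program space $A$, states $\tau_\theta$ on $A$, and a channel $\mathcal G$ independent of $\theta$, mapping states of $A\otimes B$ ($B$ being the input system) to states of $A'\otimes B'$ ($B'$ being the output system), such that $$\mathcal E_\theta(\rho)=\operatorname{tr}_{A'}\,\mathcal G(\tau_\theta\otimes\rho)\qquad\text{for all }\theta\text{ and all states }\rho .$$ Moreover $\mathcal U_\theta$ itself can be programmed probabilistically, with success probability exactly $1-\epsilon$ and with output $\rho_0$ on failure: there are such $\tau_\theta$ and completely positive maps $\mathcal G_s,\mathcal G_f$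 independent of $\theta$, whose sum is a channel, with $\operatorname{tr}_{A'}\mathcal G_s(\tau_\theta\otimes\rho)=(1-\epsilon)\,\mathcal U_\theta(\rho)$ and $\operatorname{tr}_{A'}\mathcal G_f(\tau_\theta\otimes\rho)=\epsilon\rho_0$ for all $\theta$ and all states $\rho$. **2. Standard quantum limit.** Let $\Theta$ be a subset with non-empty interior of a real normed space $V$ of finite dimension at least $1$ (for example a non-degenerate interval in $\mathbb R$), let $\{\mathcal U_\theta\}_{\theta\in\Theta}$ be channels, and suppose that $\theta\mapsto\mathcal E_\theta(\rho)$ is differentiable on $\Theta$ for every state $\rho$. A protocol with $N$ uses prepares a state of a finite-dimensional memory, then performs $N$ rounds, in each of which it applies a channel to the memory, applies the unknown channel $\mathcal E_\theta$ to one part of the result, and applies a further channel to the whole (parallel, sequential, entangled and adaptive strategies are all included); finally it performs a POVM with finitely many outcomes on the memory and outputs an estimate $\hat\theta\in V$ depending on the outcome. Its error is $\mathrm{RMSE}(\theta)=\bigl(\mathbb E_\theta\|\hat\theta-\theta\|^2\bigr)^{1/2}$. Then $\theta$ cannot be estimated faster than $\Omega(1/\sqrt N)$, however small $\epsilon$ is,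 in both of the following senses. (a) There is a constant $c>0$, depending only on the family $\{\mathcal E_\theta\}_{\theta\in\Theta}$, such that for every $N\ge1$ and every protocol with $N$ uses there is a $\theta\in\Theta$ with $\mathrm{RMSE}(\theta)\ge c/\sqrt N$. (b) For every sequence of protocols $(\mathcal P_N)_{N}$, where $\mathcal P_N$ uses the channel $N$ times, and for Lebesgue-almost every $\theta\in\Theta$, the error $\mathrm{RMSE}_N(\theta)$ of $\mathcal P_N$ is not $o(1/\sqrt N)$ as $N\to\infty$. -/

import Mathlib

open Filter Asymptotics MeasureTheory
open scoped ComplexOrder Matrix Kronecker Topology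

/-- Superoperators from operators on `ℂ^a` to operators on `ℂ^b`
(finite-dimensional Hilbert spaces with orthonormal bases indexed by `a` and `b`). -/
abbrev SuperOp (a b : Type*) : Type _ := Matrix a a ℂ →ₗ[ℂ] Matrix b b ℂ

/-- Quantum states: positive semidefinite operators of unit trace. -/
def IsState {a : Type*} [Fintype a] (ρ : Matrix a a ℂ) : Prop :=
  ρ.PosSemidef ∧ ρ.trace = 1

/-- `Φ ⊗ id`, the superoperator `Φ` acting on the first factor, next to an idle system `k`. -/
def SuperOp.tensorId {a b : Type*} (Φ : SuperOp a b) (k : Type*) :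
    SuperOp (a × k) (b × k) where
  toFun X := Matrix.of fun p q => Φ (Matrix.of fun i j => X (i, p.2) (j, q.2)) p.1 q.1
  map_add' X Y := by
    ext p q
    exact congrFun (congrFun (map_add Φ (Matrix.of fun i j => X (i, p.2) (j, q.2))
      (Matrix.of fun i j => Y (i, p.2) (j, q.2))) p.1) q.1
  map_smul' c X := by
    ext p q
    exact congrFun (congrFun (map_smul Φ c (Matrix.of fun i j => X (i, p.2) (j, q.2))) p.1) q.1

/-- Complete positivity: `Φ ⊗ id` preserves positive semidefiniteness, for every
finite-dimensional idle system. -/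
def IsCompletelyPositive {a b : Type*} (Φ : SuperOp a b) : Prop :=
  ∀ (k : ℕ) (X : Matrix (a × Fin k) (a × Fin k) ℂ),
    X.PosSemidef → (Φ.tensorId (Fin k) X).PosSemidef

/-- Quantum channels: completely positive trace-preserving superoperators. -/
def IsChannel {a b : Type*} [Fintype a] [Fintype b] (Φ : SuperOp a b) : Prop :=
  IsCompletelyPositive Φ ∧ ∀ X : Matrix a a ℂ, (Φ X).trace = X.trace

/-- Partial trace over the first tensor factor. -/
def ptraceFst {q b : Type*} [Fintype q] (X : Matrix (q × b) (q × b) ℂ) : Matrix b b ℂ :=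
  Matrix.of fun i j => ∑ s, X (s, i) (s, j)

/-- The family `E t` is programmable: there are program states `τ t` of a finite-dimensional
system and a gate `G` not depending on `t` such that `E t ρ = tr_{A'} (G (τ t ⊗ ρ))`. -/
def IsProgrammable {T a b : Type*} [Fintype a] [Fintype b] (E : T → SuperOp a b) : Prop :=
  ∃ (p q : ℕ) (τ : T → Matrix (Fin p) (Fin p) ℂ) (G : SuperOp (Fin p × a) (Fin q × b)),
    (∀ t, IsState (τ t)) ∧ IsChannel G ∧
      ∀ t ρ, IsState ρ → E t ρ = ptraceFst (G (τ t ⊗ₖ ρ))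

/-- The family `U t` is implemented by a programmed gate that announces success, with
probability `1 - ε` on every input, and that outputs the fixed state `ρ₀` whenever it announces
failure. The gate is a quantum instrument with the two branches `Gs` (success) and
`Gf` (failure). -/
def IsProgrammableWithFailure {T a b : Type*} [Fintype a] [Fintype b]
    (U : T → SuperOp a b) (ε : ℝ) (ρ₀ : Matrix b b ℂ) : Prop :=
  ∃ (p q : ℕ) (τ : T → Matrix (Fin p) (Fin p) ℂ) (Gs Gf : SuperOp (Fin p × a) (Fin q × b)),
    (∀ t, IsState (τ t)) ∧
    IsCompletelyPositive Gs ∧ IsCompletelyPositive Gf ∧ IsChannel (Gs + Gf) ∧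
      ∀ t ρ, IsState ρ →
        ptraceFst (Gs (τ t ⊗ₖ ρ)) = ((1 - ε : ℝ) : ℂ) • U t ρ ∧
        ptraceFst (Gf (τ t ⊗ₖ ρ)) = (ε : ℂ) • ρ₀

/-- `Φ` disturbed by depolarizing noise of strength `ε` towards `ρ₀`. -/
noncomputable def noisy {a b : Type*} [Fintype a] (ε : ℝ) (ρ₀ : Matrix b b ℂ)
    (Φ : SuperOp a b) : SuperOp a b :=
  (ε : ℂ) • (Matrix.traceLinearMap a ℂ ℂ).smulRight ρ₀ + ((1 - ε : ℝ) : ℂ) • Φ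

theorem noisy_apply_state {a b : Type*} [Fintype a] (ε : ℝ) (ρ₀ : Matrix b b ℂ)
    (Φ : SuperOp a b) {ρ : Matrix a a ℂ} (hρ : IsState ρ) :
    noisy ε ρ₀ Φ ρ = (ε : ℂ) • ρ₀ + ((1 - ε : ℝ) : ℂ) • Φ ρ := by
  simp [noisy, hρ.2]

/-- A protocol that estimates a parameter in `V` using an unknown channel from `ℂ^a` to `ℂ^b`
`N` times. It starts from a state of a memory. In each round the memory is processed into an
input for the unknown channel together with an auxiliary system that is kept aside, the channel
is applied, and its output and the auxiliary system are processed into a new memory. Finally the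
memory is measured and the parameter is estimated from the outcome.
All dimensions are finite and arbitrary, so that parallel uses with entangled inputs, sequential
uses, intermediate measurements with feedback, and any mixture of these are included.
(Only the data of the first `N` rounds are used.) -/
structure EstimationProtocol (a b V : Type*) [Fintype a] [Fintype b] (N : ℕ) where
  mem : ℕ → ℕ
  aux : ℕ → ℕ
  init : Matrix (Fin (mem 0)) (Fin (mem 0)) ℂ
  init_state : IsState init
  pre : ∀ i, SuperOp (Fin (mem i)) (a × Fin (aux i))
  pre_channel : ∀ i, IsChannel (pre i)
  post : ∀ i, SuperOp (b × Fin (aux i)) (Fin (mem (i + 1)))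
  post_channel : ∀ i, IsChannel (post i)
  outcomes : ℕ
  povm : Fin outcomes → Matrix (Fin (mem N)) (Fin (mem N)) ℂ
  povm_nonneg : ∀ x, (povm x).PosSemidef
  povm_sum : ∑ x, povm x = 1
  estimate : Fin outcomes → V

namespace EstimationProtocol

variable {a b V : Type*} [Fintype a] [Fintype b] {N : ℕ}

/-- The memory after `i` rounds, when the unknown channel is `Φ`. -/
def state (P : EstimationProtocol a b V N) (Φ : SuperOp a b) :
    ∀ i, Matrix (Fin (P.mem i)) (Fin (P.mem i)) ℂ
  | 0 => P.init
  | i + 1 => P.post i (Φ.tensorId (Fin (P.aux i)) (P.pre i (P.state Φ i)))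

/-- The probability of the measurement outcome `x`, when the unknown channel is `Φ`. -/
def prob (P : EstimationProtocol a b V N) (Φ : SuperOp a b) (x : Fin P.outcomes) : ℝ :=
  (P.state Φ N * P.povm x).trace.re

/-- The root mean squared error of the estimator, when the unknown channel is `Φ` and the true
value of the parameter is `θ`. -/
noncomputable def rmse [NormedAddCommGroup V] (P : EstimationProtocol a b V N)
    (Φ : SuperOp a b) (θ : V) : ℝ :=
  √(∑ x, P.prob Φ x * ‖P.estimate x - θ‖ ^ 2)

end EstimationProtocol

/-!
*Programmability.* The program of `U` consists of `N` normalized Choi states `portProgram N U`, the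
ports, each shared between a copy of the input and a copy of the output system. A joint measurement
on the input `ρ` and the input halves of all ports, with one effect `M i` for each port, teleports
`ρ` into port `i`: if `M i` is supported on the maximally entangled vector of the input and port
`i`, then that port is left with `U ρ`, exactly and for every `U` (`sum_portProgram_branch`). Let
`T i` be the unnormalized projection onto this vector (`portProj`) and `T` the sum over all `i`
(`portSum`). For any `X ≥ 0` that commutes with all `T i`, the effects `X * T i` are of this kind,
and it remains to choose `X` with `X * T ≤ 1` and with a success probability close to one.
`T` does not commute with the `T i`, but `Q = P - 2 T` does, where `P` is the sum of all swaps of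
ports: it is in essence the Casimir operator of `U^{⊗ N} ⊗ Ū`. The inequality
`Y ≤ κ / 2 + Y² / (2 κ)` and a pinching bound for the partial trace of `Y²`, `Y` being `T` minus its
mean, dominate `T` by an affine function `S` of `Q`; then a multiple of `S⁻¹` serves as `X`, and two
traces show that the success probability tends to one as `N` grows (`exists_port_measurement`). As
soon as it exceeds `1 - ε`, the surplus is given to the failure branch, which discards everything
and prepares `ρ₀`.

*Standard quantum limit.* Let `R θ` be the square root of the Choi matrix of `(1 - ε) U θ`. The
matrices `R θ * R θ'` are the Choi matrices of a map on block operators, which couples a run at `θ`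
to a run at `θ'` and preserves positivity. Its off-diagonal block distorts traces to first order in
`δ = ‖R θ - R θ'‖`; but the noise contributes `ε ρ₀` to both diagonal blocks, and hides an
off-diagonal correction `ρ₀ ⊗ W` with `W† W ≤ ε²`. For this block to keep exactly the fraction
`1 - η` of its trace, `W` has to be `ε - η` plus a matrix that is antihermitian to first order in
`δ`. Hence `W† W = (ε - η)² + O(δ²)`, and some `η = O(δ²)` is enough (`exists_choi_coupling`). After
`N` rounds the fidelity of the two memories, and with it the Bhattacharyya coefficient of the two
outcome distributions, is at least `(1 - η) ^ N`. Outcomes that are distributed so similarly cannot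
serve to estimate both `θ` and `θ'` with an error much below `‖θ - θ'‖`. If `R` is Lipschitz, this
applies to `‖θ - θ'‖` of order `1 / √N`.

Differentiability makes the Choi matrices only pointwise Lipschitz, and the square root is Lipschitz
only away from small nonzero eigenvalues. But `Θ` is a countable union of sets on which both
constants are uniform (`regularSet`). One of these sets has positive measure, and near a density
point of it there are pairs at all small distances; this gives the bound for some `θ`, for every
protocol. For the bound at almost every `θ`, consider the points of such a set at which the error is
below a small multiple of `1 / √N` from a given `N` on. They are separated by a positive distance,
so they are countable, and form a null set.
-/

/-! ### Positive semidefinite matrices -/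

section PosSemidef

open scoped MatrixOrder in
theorem Matrix.PosSemidef.exists_conjTranspose_mul_self {n : Type*} [Fintype n]
    {A : Matrix n n ℂ} (hA : A.PosSemidef) : ∃ C : Matrix n n ℂ, A = Cᴴ * C := by
  classical
  exact CStarAlgebra.nonneg_iff_eq_star_mul_self.mp hA.nonneg

open scoped MatrixOrder in
theorem Matrix.PosSemidef.mul_of_commute {n : Type*} [Fintype n] [DecidableEq n]
    {A B : Matrix n n ℂ} (hA : A.PosSemidef) (hB : B.PosSemidef) (h : Commute A B) :
    (A * B).PosSemidef :=
  Matrix.nonneg_iff_posSemidef.1 (Commute.mul_nonneg hA.nonneg hB.nonneg h)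

theorem Matrix.PosSemidef.trace_mul_nonneg {n : Type*} [Fintype n]
    {A B : Matrix n n ℂ} (hA : A.PosSemidef) (hB : B.PosSemidef) : 0 ≤ (A * B).trace := by
  obtain ⟨C, rfl⟩ := hA.exists_conjTranspose_mul_self
  rw [Matrix.mul_assoc, Matrix.trace_mul_comm]
  exact (hB.mul_mul_conjTranspose_same C).trace_nonneg

/-- The quadratic form of a Gram matrix. -/
theorem Matrix.star_dotProduct_gram {m n : Type*} [Fintype m] [Fintype n]
    (C : Matrix m n ℂ) (x : n → ℂ) :
    star x ⬝ᵥ ((Cᴴ * C) *ᵥ x) = ((∑ c, ‖∑ i, C c i * x i‖ ^ 2 : ℝ) : ℂ) := by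
  rw [← Matrix.mulVec_mulVec, Matrix.dotProduct_mulVec, Matrix.vecMul_conjTranspose, star_star,
    dotProduct]
  push_cast
  refine Finset.sum_congr rfl fun c _ => ?_
  rw [← Complex.conj_mul', Pi.star_apply]
  rfl

theorem Matrix.trace_gram {m n : Type*} [Fintype m] [Fintype n] (C : Matrix m n ℂ) :
    (Cᴴ * C).trace = ((∑ c, ∑ i, ‖C c i‖ ^ 2 : ℝ) : ℂ) := by
  rw [Matrix.trace, Finset.sum_comm]
  push_cast
  refine Finset.sum_congr rfl fun i _ => ?_
  rw [Matrix.diag_apply, Matrix.mul_apply]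
  exact Finset.sum_congr rfl fun c _ => by rw [← Complex.conj_mul']; rfl

/-- Summing a positive semidefinite matrix over an auxiliary index, independently in rows and
columns, is a compression by the all-ones vector. -/
theorem Matrix.PosSemidef.sum_aux {X I : Type*} [Fintype X] [Fintype I]
    {Q : Matrix (X × I) (X × I) ℂ} (hQ : Q.PosSemidef) :
    (Matrix.of fun x y => ∑ i, ∑ j, Q (x, i) (y, j)).PosSemidef := by
  classical
  have h := hQ.mul_mul_conjTranspose_same
    (Matrix.of fun (x : X) (z : X × I) => if x = z.1 then (1 : ℂ) else 0)
  convert h using 1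
  ext x y
  have key : ∀ z : X × I, ∑ i, Q (x, i) z = ∑ w : X × I, (if x = w.1 then (1 : ℂ) else 0) * Q w z :=
    fun z => by rw [Fintype.sum_prod_type, Finset.sum_comm]; simp
  have key' : ∀ F : X × I → ℂ, ∑ i, F (y, i) =
      ∑ w : X × I, F w * star (if y = w.1 then (1 : ℂ) else 0) :=
    fun z => by rw [Fintype.sum_prod_type, Finset.sum_comm]; simp
  simp only [Matrix.mul_apply, Matrix.of_apply, Matrix.conjTranspose_apply]
  rw [Finset.sum_comm, ← key' (fun w => ∑ j, (if x = j.1 then (1 : ℂ) else 0) * Q j w)]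
  exact Finset.sum_congr rfl fun i _ => key _

/-- A Schur product whose two factors share a summation index is positive semidefinite. -/
theorem Matrix.PosSemidef.sum_mul_submatrix {X I β γ : Type*} [Fintype X] [Fintype I]
    {J : Matrix β β ℂ} {S : Matrix γ γ ℂ} (hJ : J.PosSemidef) (hS : S.PosSemidef)
    (f : X × I → β) (g : X × I → γ) :
    (Matrix.of fun x y => ∑ i, ∑ j, J (f (x, i)) (f (y, j)) * S (g (x, i)) (g (y, j))).PosSemidef :=
  ((hJ.submatrix f).hadamard (hS.submatrix g)).sum_aux

/-- A positive semidefinite matrix is bounded by its trace. -/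
theorem Matrix.PosSemidef.trace_smul_one_sub {n : Type*} [Fintype n] [DecidableEq n]
    {A : Matrix n n ℂ} (hA : A.PosSemidef) : (A.trace • (1 : Matrix n n ℂ) - A).PosSemidef := by
  obtain ⟨C, rfl⟩ := hA.exists_conjTranspose_mul_self
  have htr := Matrix.trace_gram C
  refine .of_dotProduct_mulVec_nonneg ?_ fun x => ?_
  · rw [htr]
    refine Matrix.IsHermitian.sub ?_ (Matrix.isHermitian_conjTranspose_mul_self C)
    rw [Matrix.IsHermitian, Matrix.conjTranspose_smul, Matrix.conjTranspose_one]
    simp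
  · rw [Matrix.sub_mulVec, dotProduct_sub, Matrix.star_dotProduct_gram, htr, Matrix.smul_mulVec,
      Matrix.one_mulVec, dotProduct_smul]
    have hx : star x ⬝ᵥ x = ((∑ i, ‖x i‖ ^ 2 : ℝ) : ℂ) := by
      rw [dotProduct]
      push_cast
      exact Finset.sum_congr rfl fun c _ => by rw [← Complex.conj_mul']; rfl
    rw [hx, smul_eq_mul, ← Complex.ofReal_mul, ← Complex.ofReal_sub, Complex.zero_le_real,
      sub_nonneg, Finset.sum_mul]
    refine Finset.sum_le_sum fun c _ => ?_
    calc ‖∑ i, C c i * x i‖ ^ 2 ≤ (∑ i, ‖C c i‖ * ‖x i‖) ^ 2 := by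
          gcongr
          exact (norm_sum_le _ _).trans (Finset.sum_le_sum fun i _ => (norm_mul _ _).le)
      _ ≤ _ := Finset.sum_mul_sq_le_sq_mul_sq _ _ _

/-- The pinching-type inequality `Z ≤ d • (tr_I Z ⊗ 1)` for a positive semidefinite `Z` on a
tensor product with a second factor of dimension `d`. -/
theorem Matrix.PosSemidef.card_smul_ptrace_kronecker_one_sub {X I : Type*} [Fintype X] [Fintype I]
    [DecidableEq I] {Z : Matrix (X × I) (X × I) ℂ} (hZ : Z.PosSemidef) :
    ((Fintype.card I : ℂ) •
      ((Matrix.of fun x y => ∑ i, Z (x, i) (y, i)) ⊗ₖ (1 : Matrix I I ℂ)) - Z).PosSemidef := by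
  have hherm := hZ.isHermitian
  obtain ⟨C, rfl⟩ := hZ.exists_conjTranspose_mul_self
  refine .of_dotProduct_mulVec_nonneg ?_ fun x => ?_
  · refine Matrix.IsHermitian.sub ?_ hherm
    ext p q
    have := fun i => hherm.apply (p.1, i) (q.1, i)
    simp only [Matrix.conjTranspose_apply, Matrix.smul_apply, Matrix.kroneckerMap_apply,
      Matrix.of_apply, star_smul, star_mul', star_sum, this, Matrix.one_apply, eq_comm (a := q.2)]
    simp
  · rw [Matrix.sub_mulVec, dotProduct_sub, Matrix.star_dotProduct_gram, Matrix.smul_mulVec,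
      dotProduct_smul]
    have hx : star x ⬝ᵥ (((Matrix.of fun x y => ∑ i, (Cᴴ * C) (x, i) (y, i)) ⊗ₖ
        (1 : Matrix I I ℂ)) *ᵥ x) =
        ((∑ c, ∑ l, ∑ m, ‖∑ y, C c (y, m) * x (y, l)‖ ^ 2 : ℝ) : ℂ) := by
      have h1 : ∀ m l, star (fun y => x (y, l)) ⬝ᵥ
          (((C.submatrix id fun y => (y, m))ᴴ * (C.submatrix id fun y => (y, m))) *ᵥ
            fun y => x (y, l)) = ((∑ c, ‖∑ y, C c (y, m) * x (y, l)‖ ^ 2 : ℝ) : ℂ) :=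
        fun m l => Matrix.star_dotProduct_gram _ _
      have h2 : ((∑ c, ∑ l, ∑ m, ‖∑ y, C c (y, m) * x (y, l)‖ ^ 2 : ℝ) : ℂ) =
          ∑ l, ∑ m, ((∑ c, ‖∑ y, C c (y, m) * x (y, l)‖ ^ 2 : ℝ) : ℂ) := by
        push_cast
        rw [Finset.sum_comm]
        exact Finset.sum_congr rfl fun l _ => Finset.sum_comm
      rw [h2]
      simp only [← h1]
      simp only [dotProduct, Matrix.mulVec, Fintype.sum_prod_type, Matrix.kroneckerMap_apply,
        Matrix.of_apply, Matrix.one_apply, mul_ite, mul_one, mul_zero, ite_mul, zero_mul,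
        Finset.sum_ite_eq, Finset.mem_univ, if_true, Pi.star_apply, Finset.mul_sum, Finset.sum_mul,
        Matrix.mul_apply, Matrix.submatrix_apply, Matrix.conjTranspose_apply, id]
      rw [Finset.sum_comm]
      refine Finset.sum_congr rfl fun l _ => ?_
      conv_rhs => rw [Finset.sum_comm]
      exact Finset.sum_congr rfl fun y _ => Finset.sum_comm
    rw [hx, smul_eq_mul, ← Complex.ofReal_natCast, ← Complex.ofReal_mul, ← Complex.ofReal_sub,
      Complex.zero_le_real, sub_nonneg, Finset.mul_sum]
    refine Finset.sum_le_sum fun c _ => ?_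
    rw [Fintype.sum_prod_type, Finset.sum_comm]
    calc ‖∑ l, ∑ y, C c (y, l) * x (y, l)‖ ^ 2 ≤ (∑ l, ‖∑ y, C c (y, l) * x (y, l)‖) ^ 2 := by
          gcongr
          exact norm_sum_le _ _
      _ ≤ Fintype.card I * ∑ l, ‖∑ y, C c (y, l) * x (y, l)‖ ^ 2 := by
          simpa using sq_sum_le_card_mul_sum_sq (s := Finset.univ)
            (f := fun l => ‖∑ y, C c (y, l) * x (y, l)‖)
      _ ≤ _ := by
          gcongr with l
          exact Finset.single_le_sum (f := fun m => ‖∑ y, C c (y, m) * x (y, l)‖ ^ 2)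
            (fun _ _ => by positivity) (Finset.mem_univ l)

/-- A positive semidefinite `2 × 2` matrix has nonnegative determinant. -/
theorem Matrix.PosSemidef.norm_apply_sq_le {M : Matrix (Fin 2) (Fin 2) ℂ} (hM : M.PosSemidef) :
    ‖M 0 1‖ ^ 2 ≤ (M 0 0).re * (M 1 1).re := by
  have h0 := hM.diag_nonneg (i := 0)
  have h1 := hM.diag_nonneg (i := 1)
  have hd := hM.det_nonneg
  rw [Matrix.det_fin_two, ← hM.isHermitian.apply 1 0, ← starRingEnd_apply, Complex.mul_conj'] at hd
  have := (Complex.le_def.1 hd).1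
  rw [Complex.le_def] at h0 h1
  simp only [Complex.zero_re, Complex.zero_im] at h0 h1
  simp [Complex.sub_re, Complex.mul_re, ← h0.2, ← h1.2, ← Complex.ofReal_pow] at this
  exact this

end PosSemidef

/-! ### Superoperators and their Choi matrices -/

section Choi

variable {a b k σ : Type*}

/-- The superoperator with Choi matrix `J`. -/
def SuperOp.ofChoi [Fintype a] (J : Matrix (b × a) (b × a) ℂ) : SuperOp a b where
  toFun X := Matrix.of fun p q => ∑ i, ∑ j, J (p, i) (q, j) * X i j
  map_add' X Y := by
    ext p q
    simp [mul_add, Finset.sum_add_distrib]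
  map_smul' c X := by
    ext p q
    simp [Finset.mul_sum, mul_left_comm]

/-- The Choi matrix of a superoperator, which lists its values at the matrix units. -/
def SuperOp.choi [DecidableEq a] (Φ : SuperOp a b) : Matrix (b × a) (b × a) ℂ :=
  Matrix.of fun x y => Φ (Matrix.single x.2 y.2 1) x.1 y.1

theorem SuperOp.ofChoi_apply [Fintype a] (J : Matrix (b × a) (b × a) ℂ) (X : Matrix a a ℂ)
    (p q : b) : SuperOp.ofChoi J X p q = ∑ i, ∑ j, J (p, i) (q, j) * X i j := rfl

theorem SuperOp.ofChoi_choi [Fintype a] [DecidableEq a] (Φ : SuperOp a b) :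
    SuperOp.ofChoi Φ.choi = Φ := by
  refine LinearMap.ext fun X => ?_
  ext p q
  conv_rhs => rw [Matrix.matrix_eq_sum_single X]
  rw [SuperOp.ofChoi_apply, map_sum, Matrix.sum_apply]
  refine Finset.sum_congr rfl fun i _ => ?_
  rw [map_sum, Matrix.sum_apply]
  refine Finset.sum_congr rfl fun j _ => ?_
  rw [show Matrix.single i j (X i j) = X i j • Matrix.single i j (1 : ℂ) by simp, map_smul,
    Matrix.smul_apply, smul_eq_mul, mul_comm]
  rfl

theorem SuperOp.trace_ofChoi [Fintype a] [Fintype b] (J : Matrix (b × a) (b × a) ℂ)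
    (X : Matrix a a ℂ) :
    (SuperOp.ofChoi J X).trace = ∑ i, ∑ j, (∑ p, J (p, i) (p, j)) * X i j := by
  simp only [Matrix.trace, Matrix.diag_apply, SuperOp.ofChoi_apply]
  rw [Finset.sum_comm]
  refine Finset.sum_congr rfl fun i _ => ?_
  rw [Finset.sum_comm]
  exact Finset.sum_congr rfl fun j _ => (Finset.sum_mul _ _ _).symm

theorem SuperOp.isCompletelyPositive_ofChoi [Fintype a] [Fintype b]
    {J : Matrix (b × a) (b × a) ℂ} (hJ : J.PosSemidef) :
    IsCompletelyPositive (SuperOp.ofChoi J) := fun n _ hX =>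
  hJ.sum_mul_submatrix hX (fun z : (b × Fin n) × a => (z.1.1, z.2))
    (fun z : (b × Fin n) × a => (z.2, z.1.2))

theorem IsCompletelyPositive.choi_posSemidef [Fintype a] [DecidableEq a] {Φ : SuperOp a b}
    (h : IsCompletelyPositive Φ) : Φ.choi.PosSemidef := by
  have e := Fintype.equivFin a
  have h1 := h _ _ (Matrix.posSemidef_vecMulVec_self_star
    (fun x : a × Fin (Fintype.card a) => if x.1 = e.symm x.2 then (1 : ℂ) else 0))
  convert h1.submatrix (fun x : b × a => (x.1, e x.2)) using 1
  ext x y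
  simp only [SuperOp.choi, Matrix.of_apply, SuperOp.tensorId, LinearMap.coe_mk, AddHom.coe_mk,
    Matrix.submatrix_apply]
  refine congrFun (congrFun (congrArg Φ ?_) _) _
  ext i j
  simp only [Matrix.single_apply, Matrix.vecMulVec_apply, eq_comm, ite_and, Pi.star_apply,
    Equiv.symm_apply_apply]
  split_ifs <;> simp_all

theorem IsChannel.sum_choi_apply [Fintype a] [DecidableEq a] [Fintype b] {Φ : SuperOp a b}
    (h : IsChannel Φ) (i j : a) : ∑ p, Φ.choi (p, i) (p, j) = if i = j then 1 else 0 := by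
  have := h.2 (Matrix.single i j 1)
  rw [show ∑ p, Φ.choi (p, i) (p, j) = (Φ (Matrix.single i j 1)).trace from rfl, this]
  split_ifs with hij
  · subst hij
    simp
  · exact Matrix.trace_single_eq_of_ne _ _ _ hij

theorem IsChannel.of_choi [Fintype a] [DecidableEq a] [Fintype b] {J : Matrix (b × a) (b × a) ℂ}
    (hJ : J.PosSemidef) (htr : ∀ i j, ∑ p, J (p, i) (p, j) = if i = j then 1 else 0) :
    IsChannel (SuperOp.ofChoi J) :=
  ⟨SuperOp.isCompletelyPositive_ofChoi hJ, fun X => by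
    rw [SuperOp.trace_ofChoi]
    simp [htr, Matrix.trace]⟩

theorem SuperOp.trace_tensorId [Fintype a] [Fintype b] [Fintype k] {Φ : SuperOp a b} {c : ℂ}
    (h : ∀ X, (Φ X).trace = c * X.trace) (X : Matrix (a × k) (a × k) ℂ) :
    (Φ.tensorId k X).trace = c * X.trace := by
  have := fun s => h (Matrix.of fun i j => X (i, s) (j, s))
  simp only [Matrix.trace, Matrix.diag_apply, Matrix.of_apply] at this
  simp only [Matrix.trace, Matrix.diag_apply, Fintype.sum_prod_type]
  rw [Finset.sum_comm, Finset.sum_comm (f := fun i s => X (i, s) (i, s)), Finset.mul_sum]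
  exact Finset.sum_congr rfl fun s _ => this s

theorem IsCompletelyPositive.map_posSemidef {Φ : SuperOp a b} (h : IsCompletelyPositive Φ)
    {X : Matrix a a ℂ} (hX : X.PosSemidef) : (Φ X).PosSemidef :=
  (h 1 _ (hX.submatrix Prod.fst)).submatrix fun i => (i, 0)

theorem IsChannel.isState [Fintype a] [Fintype b] {Φ : SuperOp a b} (h : IsChannel Φ)
    {ρ : Matrix a a ℂ} (hρ : IsState ρ) : IsState (Φ ρ) :=
  ⟨h.1.map_posSemidef hρ.1, (h.2 ρ).trans hρ.2⟩

theorem IsChannel.isState_tensorId [Fintype a] [Fintype b] {Φ : SuperOp a b} (h : IsChannel Φ)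
    {n : ℕ} {ρ : Matrix (a × Fin n) (a × Fin n) ℂ} (hρ : IsState ρ) :
    IsState (Φ.tensorId (Fin n) ρ) :=
  ⟨h.1 n ρ hρ.1, by
    rw [SuperOp.trace_tensorId (c := 1) (fun X => by rw [h.2, one_mul]), one_mul, hρ.2]⟩

/-- The `(s, t)` block of an operator on a tensor product, with respect to its second factor. -/
def Matrix.tensorBlock (X : Matrix (a × σ) (a × σ) ℂ) (s t : σ) : Matrix a a ℂ :=
  X.submatrix (fun i => (i, s)) fun j => (j, t)

/-- A positive semidefinite matrix `J` acts on positive semidefinite block matrices, the `(s, t)`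
block of `J` being the Choi matrix of a superoperator that is applied to the `(s, t)` block. -/
theorem SuperOp.posSemidef_ofChoi_tensorBlock [Fintype a] [Fintype b] [Fintype k] [Fintype σ]
    {J : Matrix ((b × a) × σ) ((b × a) × σ) ℂ} (hJ : J.PosSemidef)
    {X : Matrix ((a × k) × σ) ((a × k) × σ) ℂ} (hX : X.PosSemidef) :
    (Matrix.of fun x y : (b × k) × σ =>
      (SuperOp.ofChoi (J.tensorBlock x.2 y.2)).tensorId k (X.tensorBlock x.2 y.2)
        x.1 y.1).PosSemidef :=
  hJ.sum_mul_submatrix hX (fun z : ((b × k) × σ) × a => ((z.1.1.1, z.2), z.1.2))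
    (fun z : ((b × k) × σ) × a => ((z.2, z.1.1.2), z.1.2))

end Choi

/-! ### Comparison of two runs of a protocol -/

namespace EstimationProtocol

variable {a b V : Type*} [Fintype a] [Fintype b] {N : ℕ}

theorem state_isState (P : EstimationProtocol a b V N) {Φ : SuperOp a b} (hΦ : IsChannel Φ)
    (i : ℕ) : IsState (P.state Φ i) := by
  induction i with
  | zero => exact P.init_state
  | succ i ih =>
    exact (P.post_channel i).isState (hΦ.isState_tensorId ((P.pre_channel i).isState ih))

/-- Two runs of a protocol, with the channels `Φ` and `Φ'`, are coupled through a positive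
semidefinite block operator. If the off-diagonal block of the coupling of `Φ` and `Φ'` scales the
trace by `c`, then the off-diagonal block of the coupling of the memories has trace `c ^ i` after
`i` rounds. -/
theorem exists_coupling (P : EstimationProtocol a b V N) {Φ Φ' : SuperOp a b}
    {J : Matrix ((b × a) × Fin 2) ((b × a) × Fin 2) ℂ} (hJ : J.PosSemidef)
    (h0 : SuperOp.ofChoi (J.tensorBlock 0 0) = Φ) (h1 : SuperOp.ofChoi (J.tensorBlock 1 1) = Φ')
    {c : ℂ} (hc : ∀ X, (SuperOp.ofChoi (J.tensorBlock 0 1) X).trace = c * X.trace) (i : ℕ) :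
    ∃ S : Matrix (Fin (P.mem i) × Fin 2) (Fin (P.mem i) × Fin 2) ℂ, S.PosSemidef ∧
      S.tensorBlock 0 0 = P.state Φ i ∧ S.tensorBlock 1 1 = P.state Φ' i ∧
      (S.tensorBlock 0 1).trace = c ^ i := by
  induction i with
  | zero =>
    exact ⟨P.init.submatrix Prod.fst Prod.fst, P.init_state.1.submatrix _, rfl, rfl,
      P.init_state.2.trans (pow_zero c).symm⟩
  | succ i ih =>
    obtain ⟨S, hS, hS0, hS1, hS2⟩ := ih
    have hpre : ((P.pre i).tensorId (Fin 2) S).PosSemidef := (P.pre_channel i).1 2 S hS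
    refine ⟨_, (P.post_channel i).1 2 _ (SuperOp.posSemidef_ofChoi_tensorBlock hJ hpre),
      ?_, ?_, ?_⟩
    · rw [state, ← hS0, ← h0]
      rfl
    · rw [state, ← hS1, ← h1]
      rfl
    · change (P.post i ((SuperOp.ofChoi (J.tensorBlock 0 1)).tensorId (Fin (P.aux i))
        (P.pre i (S.tensorBlock 0 1)))).trace = _
      rw [(P.post_channel i).2, SuperOp.trace_tensorId hc, (P.pre_channel i).2, hS2, pow_succ']

theorem sum_prob (P : EstimationProtocol a b V N) {Φ : SuperOp a b} (hΦ : IsChannel Φ) :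
    ∑ x, P.prob Φ x = 1 := by
  simp only [prob]
  rw [← Complex.re_sum, ← Matrix.trace_sum, ← Matrix.mul_sum, P.povm_sum, Matrix.mul_one,
    (P.state_isState hΦ N).2, Complex.one_re]

theorem prob_nonneg (P : EstimationProtocol a b V N) {Φ : SuperOp a b} (hΦ : IsChannel Φ)
    (x : Fin P.outcomes) : 0 ≤ P.prob Φ x :=
  (Complex.le_def.1 ((P.state_isState hΦ N).1.trace_mul_nonneg (P.povm_nonneg x))).1

/-- The outcome distributions of two coupled runs have fidelity at least `c ^ N`. -/
theorem pow_le_sum_sqrt_prob (P : EstimationProtocol a b V N) {Φ Φ' : SuperOp a b}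
    {J : Matrix ((b × a) × Fin 2) ((b × a) × Fin 2) ℂ} (hJ : J.PosSemidef)
    (h0 : SuperOp.ofChoi (J.tensorBlock 0 0) = Φ) (h1 : SuperOp.ofChoi (J.tensorBlock 1 1) = Φ')
    {c : ℝ} (hc : ∀ X, (SuperOp.ofChoi (J.tensorBlock 0 1) X).trace = c * X.trace) :
    c ^ N ≤ ∑ x, √(P.prob Φ x * P.prob Φ' x) := by
  obtain ⟨S, hS, hS0, hS1, hS2⟩ := P.exists_coupling hJ h0 h1 hc N
  have hblock : ∀ x, ‖(S.tensorBlock 0 1 * P.povm x).trace‖ ≤ √(P.prob Φ x * P.prob Φ' x) := by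
    intro x
    have h := hS.sum_mul_submatrix (P.povm_nonneg x).transpose
      (fun z : Fin 2 × Fin (P.mem N) => (z.2, z.1)) Prod.snd
    have h' := h.norm_apply_sq_le
    refine Real.le_sqrt_of_sq_le ?_
    rw [prob, prob, ← hS0, ← hS1]
    simp only [Matrix.trace, Matrix.diag_apply, Matrix.mul_apply]
    exact h'
  calc c ^ N ≤ ‖(c : ℂ) ^ N‖ := by
        rw [norm_pow, Complex.norm_real, Real.norm_eq_abs, ← abs_pow]
        exact le_abs_self _
    _ = ‖∑ x, (S.tensorBlock 0 1 * P.povm x).trace‖ := by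
        rw [← Matrix.trace_sum, ← Matrix.mul_sum, P.povm_sum, Matrix.mul_one, hS2]
    _ ≤ _ := (norm_sum_le _ _).trans (Finset.sum_le_sum fun x _ => hblock x)

/-- Two parameter values whose outcome distributions have large fidelity cannot both be estimated
with an error much smaller than their distance. -/
theorem mul_norm_sub_le_rmse_add_rmse [NormedAddCommGroup V] (P : EstimationProtocol a b V N)
    {Φ Φ' : SuperOp a b} (hΦ : IsChannel Φ) (hΦ' : IsChannel Φ') (θ θ' : V) :
    (∑ x, √(P.prob Φ x * P.prob Φ' x)) * ‖θ - θ'‖ ≤ P.rmse Φ θ + P.rmse Φ' θ' := by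
  have key : ∀ {p q : Fin P.outcomes → ℝ} (_ : ∀ x, 0 ≤ p x) (_ : ∀ x, 0 ≤ q x)
      (_ : ∑ x, q x = 1) (f : Fin P.outcomes → ℝ),
      ∑ x, √(p x * q x) * f x ≤ √(∑ x, p x * f x ^ 2) := by
    intro p q hp hq hq1 f
    refine Real.le_sqrt_of_sq_le ?_
    have := Finset.sum_mul_sq_le_sq_mul_sq Finset.univ (fun x => √(p x) * f x) (fun x => √(q x))
    simp only [mul_pow, Real.sq_sqrt (hp _), Real.sq_sqrt (hq _), hq1, mul_one] at this
    refine le_trans (le_of_eq ?_) this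
    congr 1
    exact Finset.sum_congr rfl fun x _ => by rw [Real.sqrt_mul (hp x)]; ring
  have h1 := key (P.prob_nonneg hΦ) (P.prob_nonneg hΦ') (P.sum_prob hΦ') fun x => ‖P.estimate x - θ‖
  have h2 := key (P.prob_nonneg hΦ') (P.prob_nonneg hΦ) (P.sum_prob hΦ)
    fun x => ‖P.estimate x - θ'‖
  refine le_trans ?_ (add_le_add h1 h2)
  rw [Finset.sum_mul, ← Finset.sum_add_distrib]
  refine Finset.sum_le_sum fun x _ => ?_
  rw [mul_comm (P.prob Φ' x), ← mul_add]
  gcongr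
  calc ‖θ - θ'‖ = ‖(P.estimate x - θ') - (P.estimate x - θ)‖ := by congr 1; abel
    _ ≤ _ := (norm_sub_le _ _).trans (add_comm _ _).le

end EstimationProtocol

/-! ### Coupling two noisy channels -/

section Coupling

variable {a b : Type*}

theorem ptraceFst_sub [Fintype b] (X Y : Matrix (b × a) (b × a) ℂ) :
    ptraceFst (X - Y) = ptraceFst X - ptraceFst Y := by
  ext i j
  simp [ptraceFst]

theorem conjTranspose_ptraceFst [Fintype b] (X : Matrix (b × a) (b × a) ℂ) :
    (ptraceFst X)ᴴ = ptraceFst Xᴴ := by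
  ext i j
  simp [ptraceFst]

theorem trace_ptraceFst [Fintype a] [Fintype b] (X : Matrix (b × a) (b × a) ℂ) :
    (ptraceFst X).trace = X.trace := by
  simp only [Matrix.trace, Matrix.diag_apply, ptraceFst, Matrix.of_apply, Fintype.sum_prod_type]
  exact Finset.sum_comm

theorem Matrix.PosSemidef.ptraceFst [Fintype b] {X : Matrix (b × a) (b × a) ℂ}
    (hX : X.PosSemidef) : (ptraceFst X).PosSemidef := by
  have h := Matrix.posSemidef_sum Finset.univ fun s _ => hX.submatrix fun i : a => ((s, i) : b × a)
  convert h using 1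
  ext i j
  simp [_root_.ptraceFst, Matrix.sum_apply]

/-- Cauchy-Schwarz for the partial trace of a product, in the Hilbert-Schmidt norm. -/
theorem sum_norm_ptraceFst_mul_sq_le [Fintype a] [Fintype b] (X Y : Matrix (b × a) (b × a) ℂ) :
    ∑ i, ∑ j, ‖ptraceFst (X * Y) i j‖ ^ 2 ≤
      (∑ x, ∑ y, ‖X x y‖ ^ 2) * ∑ x, ∑ y, ‖Y x y‖ ^ 2 := by
  have hX : ∑ x, ∑ y, ‖X x y‖ ^ 2 = ∑ i, ∑ z : b × (b × a), ‖X (z.1, i) z.2‖ ^ 2 := by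
    simp only [Fintype.sum_prod_type (α₁ := b)]
    exact Finset.sum_comm
  have hY : ∑ x, ∑ y, ‖Y x y‖ ^ 2 = ∑ j, ∑ z : b × (b × a), ‖Y z.2 (z.1, j)‖ ^ 2 := by
    rw [Finset.sum_comm]
    simp only [Fintype.sum_prod_type (α₁ := b)]
    rw [Finset.sum_comm]
  rw [hX, hY, Finset.sum_mul_sum]
  refine Finset.sum_le_sum fun i _ => Finset.sum_le_sum fun j _ => ?_
  have hsum : ptraceFst (X * Y) i j = ∑ z : b × (b × a), X (z.1, i) z.2 * Y z.2 (z.1, j) := by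
    rw [Fintype.sum_prod_type]
    rfl
  rw [hsum]
  calc _ ≤ (∑ z : b × (b × a), ‖X (z.1, i) z.2‖ * ‖Y z.2 (z.1, j)‖) ^ 2 := by
        gcongr
        exact (norm_sum_le _ _).trans (Finset.sum_le_sum fun z _ => (norm_mul _ _).le)
    _ ≤ _ := Finset.sum_mul_sq_le_sq_mul_sq _ _ _

/-- The block matrix `[[ε, W], [Wᴴ, ε]]`, with the block index as second tensor factor, is positive
semidefinite when `W` has operator norm at most `ε`. -/
theorem posSemidef_blocks_of_contraction [Fintype a] [DecidableEq a] {ε : ℝ} (hε : 0 < ε)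
    {W : Matrix a a ℂ} (hW : (((ε ^ 2 : ℝ) : ℂ) • (1 : Matrix a a ℂ) - Wᴴ * W).PosSemidef) :
    (Matrix.fromBlocks ((ε : ℂ) • (1 : Matrix a a ℂ)) W Wᴴ ((ε : ℂ) • 1)).PosSemidef := by
  have hε' : (ε : ℂ) ≠ 0 := by exact_mod_cast hε.ne'
  have hpd : ((ε : ℂ) • (1 : Matrix a a ℂ)).PosDef :=
    Matrix.PosDef.one.smul (by exact_mod_cast hε)
  have hinv : ((ε : ℂ) • (1 : Matrix a a ℂ))⁻¹ = (ε : ℂ)⁻¹ • 1 := by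
    refine Matrix.inv_eq_left_inv ?_
    rw [smul_mul_smul_comm, Matrix.one_mul, inv_mul_cancel₀ hε', one_smul]
  let := hpd.isUnit.invertible
  rw [Matrix.PosDef.fromBlocks₁₁ _ _ hpd, hinv]
  have h := hW.smul (α := ℂ) (a := ((ε⁻¹ : ℝ) : ℂ)) (by
    rw [Complex.zero_le_real]; positivity)
  rw [smul_sub, smul_smul] at h
  rw [Matrix.mul_smul, Matrix.mul_one, Matrix.smul_mul, ← Complex.ofReal_inv]
  have e : ε⁻¹ * ε ^ 2 = ε := by field_simp
  rwa [← Complex.ofReal_mul, e] at h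

/-- Let `R 0 ^ 2` and `R 1 ^ 2` be the Choi matrices of the noiseless parts of two channels. The
off-diagonal block of the coupling is the sum of `R 0 * R 1` and of a correction that is absorbed
by the noise. The correction makes the off-diagonal block scale the trace by the number `1 - η`; it
has to be a contraction up to the factor `ε`, and it is one when `η` is of second order in the
distance of `R 0` and `R 1`, since the first-order part of the required correction is
antihermitian. -/
theorem exists_choi_coupling [Fintype a] [Fintype b] [DecidableEq a] {ε : ℝ} (hε₀ : 0 < ε)
    {ρ₀ : Matrix b b ℂ} (hρ₀ : IsState ρ₀)
    (R : Fin 2 → Matrix (b × a) (b × a) ℂ) (hR : ∀ s, (R s).IsHermitian)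
    (htr : ∀ s, ptraceFst (R s * R s) = ((1 - ε : ℝ) : ℂ) • 1) {η : ℝ} (hη₀ : 0 ≤ η) (hη₁ : η ≤ ε)
    (hη : (ε + Fintype.card a) * ∑ x, ∑ y, ‖R 0 x y - R 1 x y‖ ^ 2 ≤ η * ε) :
    ∃ J : Matrix ((b × a) × Fin 2) ((b × a) × Fin 2) ℂ, J.PosSemidef ∧
      (∀ s, SuperOp.ofChoi (J.tensorBlock s s) = SuperOp.ofChoi (R s * R s) +
        (ε : ℂ) • (Matrix.traceLinearMap a ℂ ℂ).smulRight ρ₀) ∧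
      ∀ X, (SuperOp.ofChoi (J.tensorBlock 0 1) X).trace = ((1 - η : ℝ) : ℂ) * X.trace := by
  set D := R 0 - R 1 with hD
  set δ := ∑ x, ∑ y, ‖R 0 x y - R 1 x y‖ ^ 2 with hδ
  have hδ₀ : 0 ≤ δ := by positivity
  set G := ptraceFst (R 0 * D) with hG
  set W : Matrix a a ℂ := ((1 - η : ℝ) : ℂ) • 1 - ptraceFst (R 0 * R 1) with hW
  have hDh : Dᴴ = D := (hR 0).sub (hR 1)
  -- `W` is a multiple of the identity up to `G`, which is of first order, while `Gᴴ + G` is of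
  -- second order; so `Wᴴ * W` differs from `(ε - η) ^ 2` by multiples of the squared distance `δ`
  have hWG : W = ((ε - η : ℝ) : ℂ) • 1 + G := by
    rw [hG, hD, Matrix.mul_sub, ptraceFst_sub, htr 0, hW]
    push_cast
    module
  have hQ : Gᴴ + G = ptraceFst (Dᴴ * D) := by
    have e : Dᴴ * D = R 0 * R 0 - R 0 * R 1 - (R 1 * R 0 - R 1 * R 1) := by
      rw [hDh, hD]
      noncomm_ring
    rw [e, hG, conjTranspose_ptraceFst, hD, Matrix.conjTranspose_mul, Matrix.conjTranspose_sub,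
      hR 0, hR 1, Matrix.mul_sub, Matrix.sub_mul]
    simp only [ptraceFst_sub, htr]
    abel
  have hQtr : (ptraceFst (Dᴴ * D)).trace = (δ : ℂ) := by
    rw [trace_ptraceFst, Matrix.trace_gram]
    rfl
  have hQle := (Matrix.posSemidef_conjTranspose_mul_self D).ptraceFst.trace_smul_one_sub
  rw [hQtr, ← hQ] at hQle
  have hR0 : ∑ x, ∑ y, ‖R 0 x y‖ ^ 2 = (1 - ε) * Fintype.card a := by
    have h := Matrix.trace_gram (R 0)
    rw [hR 0, ← trace_ptraceFst, htr, Matrix.trace_smul, Matrix.trace_one, smul_eq_mul] at h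
    exact_mod_cast h.symm
  have hGle := (Matrix.posSemidef_conjTranspose_mul_self G).trace_smul_one_sub
  rw [Matrix.trace_gram] at hGle
  set g := ∑ c, ∑ i, ‖G c i‖ ^ 2 with hg
  have hgle : g ≤ Fintype.card a * δ := by
    refine (sum_norm_ptraceFst_mul_sq_le _ _).trans ?_
    rw [hR0, hδ]
    gcongr ?_ * ?_
    · exact mul_le_of_le_one_left (by positivity) (by linarith)
    · exact le_rfl
  have hcontr : (((ε ^ 2 : ℝ) : ℂ) • (1 : Matrix a a ℂ) - Wᴴ * W).PosSemidef := by
    have e : ((ε ^ 2 : ℝ) : ℂ) • (1 : Matrix a a ℂ) - Wᴴ * W =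
        ((ε ^ 2 - (ε - η) ^ 2 - (ε - η) * δ - g : ℝ) : ℂ) • (1 : Matrix a a ℂ) +
          ((ε - η : ℝ) : ℂ) • ((δ : ℂ) • 1 - (Gᴴ + G)) + ((g : ℂ) • 1 - Gᴴ * G) := by
      rw [hWG, Matrix.conjTranspose_add, Matrix.conjTranspose_smul, Matrix.conjTranspose_one,
        ← starRingEnd_apply, Complex.conj_ofReal]
      simp only [Matrix.add_mul, Matrix.mul_add, Matrix.smul_mul, Matrix.mul_smul, Matrix.mul_one,
        Matrix.one_mul]
      push_cast
      module
    rw [e]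
    refine ((Matrix.PosSemidef.one.smul ?_).add (hQle.smul ?_)).add hGle
    · rw [Complex.zero_le_real]
      nlinarith
    · rw [Complex.zero_le_real]
      linarith
  have hV := (posSemidef_blocks_of_contraction hε₀ hcontr).submatrix
    (fun z : a × Fin 2 => if z.2 = 0 then Sum.inl z.1 else Sum.inr z.1)
  set V := (Matrix.fromBlocks ((ε : ℂ) • (1 : Matrix a a ℂ)) W Wᴴ ((ε : ℂ) • 1)).submatrix
    (fun z : a × Fin 2 => if z.2 = 0 then Sum.inl z.1 else Sum.inr z.1)
    (fun z : a × Fin 2 => if z.2 = 0 then Sum.inl z.1 else Sum.inr z.1) with hVdef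
  have hVss : ∀ s i j, V (i, s) (j, s) = (ε : ℂ) * (1 : Matrix a a ℂ) i j := by
    intro s i j
    fin_cases s <;> simp [hVdef]
  have hV01 : ∀ i j, V (i, 0) (j, 1) = W i j := fun i j => by simp [hVdef]
  -- the noiseless part and the part generated by the noise
  let J₁ : Matrix ((b × a) × Fin 2) ((b × a) × Fin 2) ℂ :=
    Matrix.of fun x y => (R x.2 * R y.2) x.1 y.1
  let J₂ : Matrix ((b × a) × Fin 2) ((b × a) × Fin 2) ℂ :=
    Matrix.of fun x y => ρ₀ x.1.1 y.1.1 * V (x.1.2, x.2) (y.1.2, y.2)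
  have hJ₁ : J₁.PosSemidef := by
    have h := Matrix.posSemidef_self_mul_conjTranspose
      (Matrix.of fun (x : (b × a) × Fin 2) (z : b × a) => R x.2 x.1 z)
    convert h using 1
    ext x y
    simp only [J₁, Matrix.of_apply, Matrix.mul_apply, Matrix.conjTranspose_apply]
    exact Finset.sum_congr rfl fun z _ => by rw [(hR y.2).apply]
  have hJ₂ : J₂.PosSemidef := (hρ₀.1.submatrix fun x : (b × a) × Fin 2 => x.1.1).hadamard
    (hV.submatrix fun x : (b × a) × Fin 2 => (x.1.2, x.2))
  refine ⟨J₁ + J₂, hJ₁.add hJ₂, fun s => ?_, fun X => ?_⟩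
  · refine LinearMap.ext fun X => ?_
    ext p q
    simp only [SuperOp.ofChoi_apply, LinearMap.add_apply, LinearMap.smul_apply,
      LinearMap.smulRight_apply, Matrix.add_apply, Matrix.smul_apply, Matrix.traceLinearMap_apply,
      Matrix.tensorBlock, Matrix.submatrix_apply, J₁, J₂, Matrix.of_apply, hVss, add_mul,
      Finset.sum_add_distrib, smul_eq_mul, Matrix.trace, Matrix.diag_apply, Matrix.one_apply]
    congr 1
    simp only [mul_ite, mul_one, mul_zero, ite_mul, zero_mul, Finset.sum_ite_eq, Finset.mem_univ,
      if_true, Finset.sum_mul, Finset.mul_sum]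
    exact Finset.sum_congr rfl fun i _ => by ring
  · rw [SuperOp.trace_ofChoi]
    have h : ∀ i j, ∑ p, (J₁ + J₂).tensorBlock 0 1 (p, i) (p, j) =
        ((1 - η : ℝ) : ℂ) * (1 : Matrix a a ℂ) i j := by
      intro i j
      simp only [Matrix.tensorBlock, Matrix.submatrix_apply, Matrix.add_apply, J₁, J₂,
        Matrix.of_apply, hV01, Finset.sum_add_distrib, ← Finset.sum_mul]
      rw [show ∑ p, ρ₀ p p = 1 from hρ₀.2, hW]
      simp [ptraceFst]
    simp only [h, Matrix.one_apply]
    simp [Matrix.trace, Finset.mul_sum]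

end Coupling

/-! ### Square roots of positive semidefinite matrices -/

section Sqrt

variable {n : Type*} [Fintype n] [DecidableEq n]

/-- The square root of a positive semidefinite matrix, by diagonalization. -/
noncomputable def Matrix.IsHermitian.spectralSqrt {A : Matrix n n ℂ} (hA : A.IsHermitian) :
    Matrix n n ℂ :=
  (hA.eigenvectorUnitary : Matrix n n ℂ) *
    Matrix.diagonal (fun i => ((√(hA.eigenvalues i) : ℝ) : ℂ)) *
    (hA.eigenvectorUnitary : Matrix n n ℂ)ᴴ

theorem Matrix.IsHermitian.eq_diagonalization {A : Matrix n n ℂ} (hA : A.IsHermitian) :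
    A = (hA.eigenvectorUnitary : Matrix n n ℂ) *
      Matrix.diagonal (fun i => ((hA.eigenvalues i : ℝ) : ℂ)) *
        (hA.eigenvectorUnitary : Matrix n n ℂ)ᴴ :=
  hA.spectral_theorem

theorem Matrix.IsHermitian.isHermitian_spectralSqrt {A : Matrix n n ℂ} (hA : A.IsHermitian) :
    hA.spectralSqrt.IsHermitian := by
  refine Matrix.isHermitian_mul_mul_conjTranspose _ ?_
  rw [Matrix.isHermitian_diagonal_iff]
  intro i
  simp [IsSelfAdjoint, ← starRingEnd_apply]

theorem Matrix.PosSemidef.spectralSqrt_mul_self {A : Matrix n n ℂ} (hA : A.PosSemidef) :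
    hA.isHermitian.spectralSqrt * hA.isHermitian.spectralSqrt = A := by
  have hU := Unitary.coe_star_mul_self hA.isHermitian.eigenvectorUnitary
  rw [Matrix.star_eq_conjTranspose] at hU
  conv_rhs => rw [hA.isHermitian.eq_diagonalization]
  rw [Matrix.IsHermitian.spectralSqrt]
  set U := (hA.isHermitian.eigenvectorUnitary : Matrix n n ℂ)
  rw [show ∀ D : Matrix n n ℂ, U * D * Uᴴ * (U * D * Uᴴ) = U * D * (Uᴴ * U) * D * Uᴴ from
    fun D => by noncomm_ring, hU, Matrix.mul_one, Matrix.mul_assoc U, Matrix.diagonal_mul_diagonal]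
  congr 3
  ext i
  rw [← Complex.ofReal_mul, Real.mul_self_sqrt (hA.eigenvalues_nonneg i)]

/-- The Hilbert-Schmidt distance of two matrices in terms of their diagonalizations. -/
theorem sum_norm_sub_sq_eq_of_diagonalization {U V : Matrix n n ℂ}
    (hU : U * Uᴴ = 1) (hV : V * Vᴴ = 1) (f g : n → ℝ) :
    ∑ x, ∑ y, ‖(U * Matrix.diagonal (fun i => ((f i : ℝ) : ℂ)) * Uᴴ) x y -
        (V * Matrix.diagonal (fun i => ((g i : ℝ) : ℂ)) * Vᴴ) x y‖ ^ 2 =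
      ∑ i, ∑ j, (f i - g j) ^ 2 * ‖(Uᴴ * V) i j‖ ^ 2 := by
  have hU' : Uᴴ * U = 1 := mul_eq_one_comm.1 hU
  have hV' : Vᴴ * V = 1 := mul_eq_one_comm.1 hV
  set M := U * Matrix.diagonal (fun i => ((f i : ℝ) : ℂ)) * Uᴴ -
    V * Matrix.diagonal (fun i => ((g i : ℝ) : ℂ)) * Vᴴ with hM
  have h1 : Uᴴ * M * V = Matrix.of fun i j => ((f i - g j : ℝ) : ℂ) * (Uᴴ * V) i j := by
    have : Uᴴ * M * V = (Uᴴ * U) * Matrix.diagonal (fun i => ((f i : ℝ) : ℂ)) * (Uᴴ * V) -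
        (Uᴴ * V) * Matrix.diagonal (fun i => ((g i : ℝ) : ℂ)) * (Vᴴ * V) := by
      rw [hM]
      noncomm_ring
    rw [this, hU', hV', Matrix.one_mul, Matrix.mul_one]
    ext i j
    rw [Matrix.sub_apply, Matrix.diagonal_mul, Matrix.mul_diagonal, Matrix.of_apply]
    push_cast
    ring
  have h2 : ((Uᴴ * M * V)ᴴ * (Uᴴ * M * V)).trace = (Mᴴ * M).trace := by
    have : (Uᴴ * M * V)ᴴ * (Uᴴ * M * V) = Vᴴ * (Mᴴ * (U * Uᴴ) * M * V) := by
      simp only [Matrix.conjTranspose_mul, Matrix.conjTranspose_conjTranspose, Matrix.mul_assoc]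
    rw [this, Matrix.trace_mul_comm, hU, Matrix.mul_one, Matrix.mul_assoc, hV, Matrix.mul_one]
  rw [h1, Matrix.trace_gram, Matrix.trace_gram] at h2
  refine (Complex.ofReal_injective h2).symm.trans ?_
  refine Finset.sum_congr rfl fun i _ => Finset.sum_congr rfl fun j _ => ?_
  rw [Matrix.of_apply, norm_mul, mul_pow, Complex.norm_real, Real.norm_eq_abs, sq_abs]

/-- The square root is Lipschitz, in the Hilbert-Schmidt norm, on positive semidefinite matrices
whose nonzero eigenvalues are at least `κ`, whatever their ranks. -/
theorem sum_norm_spectralSqrt_sub_sq_le {A B : Matrix n n ℂ} (hA : A.PosSemidef)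
    (hB : B.PosSemidef) {κ : ℝ}
    (hκA : ∀ i, hA.isHermitian.eigenvalues i = 0 ∨ κ ≤ hA.isHermitian.eigenvalues i)
    (hκB : ∀ i, hB.isHermitian.eigenvalues i = 0 ∨ κ ≤ hB.isHermitian.eigenvalues i) :
    κ * ∑ x, ∑ y, ‖hA.isHermitian.spectralSqrt x y - hB.isHermitian.spectralSqrt x y‖ ^ 2 ≤
      ∑ x, ∑ y, ‖A x y - B x y‖ ^ 2 := by
  have hU : (hA.isHermitian.eigenvectorUnitary : Matrix n n ℂ) *
      (hA.isHermitian.eigenvectorUnitary : Matrix n n ℂ)ᴴ = 1 := Unitary.coe_mul_star_self _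
  have hV : (hB.isHermitian.eigenvectorUnitary : Matrix n n ℂ) *
      (hB.isHermitian.eigenvectorUnitary : Matrix n n ℂ)ᴴ = 1 := Unitary.coe_mul_star_self _
  have hR := sum_norm_sub_sq_eq_of_diagonalization hU hV
    hA.isHermitian.eigenvalues hB.isHermitian.eigenvalues
  rw [← hA.isHermitian.eq_diagonalization, ← hB.isHermitian.eq_diagonalization] at hR
  rw [hR, Matrix.IsHermitian.spectralSqrt, Matrix.IsHermitian.spectralSqrt,
    sum_norm_sub_sq_eq_of_diagonalization hU hV, Finset.mul_sum]
  refine Finset.sum_le_sum fun i _ => ?_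
  rw [Finset.mul_sum]
  refine Finset.sum_le_sum fun j _ => ?_
  rw [← mul_assoc]
  refine mul_le_mul_of_nonneg_right ?_ (by positivity)
  have key : ∀ x y : ℝ, 0 ≤ x → 0 ≤ y → (x = 0 ∨ κ ≤ x) → (y = 0 ∨ κ ≤ y) →
      κ * (√x - √y) ^ 2 ≤ (x - y) ^ 2 := by
    intro x y hx hy hx' hy'
    have e : (x - y) ^ 2 = (√x + √y) ^ 2 * (√x - √y) ^ 2 := by
      conv_lhs => rw [← Real.sq_sqrt hx, ← Real.sq_sqrt hy]
      ring
    have hxs := Real.sq_sqrt hx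
    have hys := Real.sq_sqrt hy
    have hxy := mul_nonneg (Real.sqrt_nonneg x) (Real.sqrt_nonneg y)
    rcases hx' with rfl | hx'
    · rcases hy' with rfl | hy'
      · simp
      · rw [e]
        exact mul_le_mul_of_nonneg_right (by nlinarith) (sq_nonneg _)
    · rw [e]
      exact mul_le_mul_of_nonneg_right (by nlinarith) (sq_nonneg _)
  exact key _ _ (hA.eigenvalues_nonneg i) (hB.eigenvalues_nonneg j) (hκA i) (hκB j)

/-- The nonzero eigenvalues of a positive semidefinite matrix are bounded away from zero. -/
theorem Matrix.PosSemidef.exists_gap {A : Matrix n n ℂ} (hA : A.PosSemidef) :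
    ∃ κ : ℝ, 0 < κ ∧ ∀ i, hA.isHermitian.eigenvalues i = 0 ∨ κ ≤ hA.isHermitian.eigenvalues i := by
  have h : ∀ i, ∃ κ : ℝ, 0 < κ ∧
      (hA.isHermitian.eigenvalues i = 0 ∨ κ ≤ hA.isHermitian.eigenvalues i) := by
    intro i
    rcases (hA.eigenvalues_nonneg i).eq_or_lt with h | h
    · exact ⟨1, one_pos, .inl h.symm⟩
    · exact ⟨_, h, .inr le_rfl⟩
  choose κ hκ hκ' using h
  obtain ⟨c, hc, hc'⟩ : ∃ c : ℝ, 0 < c ∧ ∀ i, c ≤ κ i := by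
    rcases isEmpty_or_nonempty n with hn | hn
    · exact ⟨1, one_pos, fun i => hn.elim i⟩
    · obtain ⟨i, hi⟩ := Finite.exists_min κ
      exact ⟨κ i, hκ i, hi⟩
  exact ⟨c, hc, fun i => (hκ' i).imp_right (hc' i).trans⟩

end Sqrt

/-! ### Points of a set of positive measure at prescribed distances -/

section Geometry

variable {V : Type*} [NormedAddCommGroup V]

/-- A set of positive Haar measure contains pairs of points at distance comparable to `r`, for all
small scales `r`. -/
theorem exists_pairs_of_measure_ne_zero [NormedSpace ℝ V] [FiniteDimensional ℝ V]
    [Nontrivial V] [MeasurableSpace V] [BorelSpace V] (μ : Measure V) [μ.IsAddHaarMeasure]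
    {S : Set V} (hS : μ S ≠ 0) :
    ∃ r₀ : ℝ, 0 < r₀ ∧ ∀ r, 0 < r → r ≤ r₀ → ∃ θ ∈ S, ∃ θ' ∈ S,
      r / 4 ≤ ‖θ - θ'‖ ∧ ‖θ - θ'‖ ≤ 2 * r := by
  have hne : (ae (μ.restrict S)).NeBot := by
    rw [ae_neBot, Ne, Measure.restrict_eq_zero]
    exact hS
  obtain ⟨x, hx⟩ := (Besicovitch.ae_tendsto_measure_inter_div μ S).exists
  have hlt : ∀ᶠ r in 𝓝[>] (0 : ℝ), ENNReal.ofReal (1 / 4) <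
      μ (S ∩ Metric.closedBall x r) / μ (Metric.closedBall x r) := by
    refine hx.eventually_const_lt ?_
    rw [ENNReal.ofReal_lt_one]
    norm_num
  obtain ⟨r₁, hr₁, hr₁'⟩ := mem_nhdsGT_iff_exists_Ioo_subset.1 hlt
  have hr₁₀ : 0 < r₁ := hr₁
  refine ⟨r₁ / 2, by positivity, fun r hr hrr => ?_⟩
  have hratio : ENNReal.ofReal (1 / 4) <
      μ (S ∩ Metric.closedBall x r) / μ (Metric.closedBall x r) := hr₁' ⟨hr, by linarith⟩
  obtain ⟨y, hyS, hyr⟩ : (S ∩ Metric.closedBall x r).Nonempty := by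
    by_contra hempty
    rw [Set.not_nonempty_iff_eq_empty.1 hempty] at hratio
    simp at hratio
  by_contra hno
  push Not at hno
  -- otherwise the set is concentrated in a ball of radius `r / 4` around one of its points
  have hsub : S ∩ Metric.closedBall x r ⊆ Metric.closedBall y (r / 4) := by
    rintro z ⟨hzS, hzr⟩
    rw [Metric.mem_closedBall, dist_eq_norm] at *
    by_contra hz
    have h1 := hno z hzS y hyS (not_le.1 hz).le
    have h2 : ‖z - y‖ ≤ ‖z - x‖ + ‖y - x‖ := by
      calc ‖z - y‖ = ‖(z - x) - (y - x)‖ := by congr 1; abel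
        _ ≤ _ := norm_sub_le _ _
    linarith
  have hball : μ (Metric.closedBall y (r / 4)) ≤
      ENNReal.ofReal (1 / 4) * μ (Metric.closedBall x r) := by
    rw [Measure.addHaar_closedBall' μ y (by positivity), Measure.addHaar_closedBall' μ x hr.le,
      ← mul_assoc, ← ENNReal.ofReal_mul (by positivity)]
    gcongr
    have hd : Module.finrank ℝ V ≠ 0 := Module.finrank_pos.ne'
    rw [div_eq_mul_one_div, mul_pow, mul_comm]
    gcongr
    exact pow_le_of_le_one (by norm_num) (by norm_num) hd
  have hpos : μ (Metric.closedBall x r) ≠ 0 := (Metric.measure_closedBall_pos μ x hr).ne'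
  have hfin : μ (Metric.closedBall x r) ≠ ⊤ := measure_closedBall_lt_top.ne
  refine absurd hratio (not_lt.2 ?_)
  rw [ENNReal.div_le_iff hpos hfin]
  exact (measure_mono hsub).trans hball

/-- A set whose points keep a fixed distance from each other is countable. -/
theorem Set.countable_of_forall_le_norm_sub [NormedSpace ℝ V] [FiniteDimensional ℝ V] {S : Set V}
    {ρ : ℝ} (hρ : 0 < ρ) (h : ∀ θ ∈ S, ∀ θ' ∈ S, ‖θ - θ'‖ < ρ → θ = θ') : S.Countable := by
  have : ProperSpace V := FiniteDimensional.proper ℝ V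
  have hd : DiscreteTopology S := by
    refine DiscreteTopology.of_forall_le_dist hρ ?_
    intro x y hxy
    by_contra hlt
    exact hxy (Subtype.ext (h _ x.2 _ y.2 (by rw [← dist_eq_norm]; exact not_le.1 hlt)))
  exact Set.countable_coe_iff.1 (TopologicalSpace.separableSpace_iff_countable.1 inferInstance)

/-- If the errors `f N` of estimates cannot both be small at points at distance of order `1 / √N`,
then they are `o(1 / √N)` at most at countably many points. -/
theorem countable_setOf_isLittleO [NormedSpace ℝ V] [FiniteDimensional ℝ V] {S : Set V}
    {C r : ℝ} (hC : 0 < C) (hr : 0 < r) (f : ℕ → V → ℝ)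
    (hf : ∀ N, ∀ θ ∈ S, ∀ θ' ∈ S, ‖θ - θ'‖ < r →
      (1 - N * (C * ‖θ - θ'‖ ^ 2)) * ‖θ - θ'‖ ≤ f N θ + f N θ') :
    {θ ∈ S | (fun N => f N θ) =o[atTop] fun N : ℕ => 1 / √(N : ℝ)}.Countable := by
  -- small enough that `64 * C * c ^ 2 < 1`, which the last step contradicts
  set c := 1 / (16 * (C + 1)) with hc
  have hc₀ : 0 < c := by positivity
  have hsub : {θ ∈ S | (fun N => f N θ) =o[atTop] fun N : ℕ => 1 / √(N : ℝ)} ⊆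
      ⋃ k : ℕ, {θ ∈ S | ∀ N ≥ k, f N θ ≤ c * (1 / √(N : ℝ))} := by
    rintro θ ⟨hθ, hθ'⟩
    obtain ⟨k, hk⟩ := eventually_atTop.1 (hθ'.def hc₀)
    refine Set.mem_iUnion.2 ⟨k, hθ, fun N hN => (le_abs_self _).trans ?_⟩
    have h := hk N hN
    rwa [Real.norm_eq_abs, Real.norm_of_nonneg (by positivity)] at h
  refine (Set.countable_iUnion fun k => ?_).mono hsub
  -- below this distance some `N ≥ k` is of the order of the inverse squared distance
  set ρ := min r (min 1 (1 / (2 * C * (k + 1)))) with hρ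
  have hρ₀ : 0 < ρ := by positivity
  refine Set.countable_of_forall_le_norm_sub hρ₀ ?_
  rintro θ ⟨hθ, hθk⟩ θ' ⟨hθ', hθk'⟩ hlt
  by_contra hne
  set δ := ‖θ - θ'‖ with hδ
  have hδ₀ : 0 < δ := norm_pos_iff.2 (sub_ne_zero.2 hne)
  have hδr : δ < r := hlt.trans_le (min_le_left _ _)
  have hδ1 : δ < 1 := hlt.trans_le ((min_le_right _ _).trans (min_le_left _ _))
  have hδk : δ < 1 / (2 * C * (k + 1)) :=
    hlt.trans_le ((min_le_right _ _).trans (min_le_right _ _))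
  set y := 1 / (2 * C * δ ^ 2) with hy
  have hky : (k : ℝ) + 1 ≤ y := by
    rw [hy, le_div_iff₀ (by positivity)]
    rw [lt_div_iff₀ (by positivity)] at hδk
    have : δ ^ 2 ≤ δ := by nlinarith
    have h2 : 0 ≤ 2 * C * ((k : ℝ) + 1) := by positivity
    nlinarith [mul_le_mul_of_nonneg_left this h2]
  set N := ⌊y⌋₊ with hN
  have hNk : k ≤ N := Nat.le_floor (by linarith)
  have hNy : (N : ℝ) ≤ y := Nat.floor_le (by positivity)
  have hNy' : y < N + 1 := Nat.lt_floor_add_one y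
  have hk0 : (0 : ℝ) ≤ k := by positivity
  have hN1 : (1 : ℝ) ≤ N := by
    exact_mod_cast (Nat.le_floor (by push_cast; linarith) : 1 ≤ N)
  have hyδ : y * (2 * C * δ ^ 2) = 1 := by rw [hy]; field_simp
  have h1 := hf N θ hθ θ' hθ' hδr
  have h2 := hθk N hNk
  have h3 := hθk' N hNk
  have hNC : (N : ℝ) * (C * δ ^ 2) ≤ 1 / 2 := by
    have : 0 ≤ C * δ ^ 2 := by positivity
    nlinarith
  have h4 : δ / 2 ≤ 2 * c * (1 / √(N : ℝ)) := by nlinarith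
  have hs : 0 < √(N : ℝ) := Real.sqrt_pos.2 (by linarith)
  have h5 : δ * √(N : ℝ) ≤ 4 * c := by
    rw [mul_one_div, le_div_iff₀ hs] at h4
    linarith
  have h6 : δ ^ 2 * N ≤ 16 * c ^ 2 := by
    have := pow_le_pow_left₀ (by positivity) h5 2
    rw [mul_pow, Real.sq_sqrt (by positivity)] at this
    linarith
  have h7 : 1 ≤ 4 * C * (δ ^ 2 * N) := by
    have : 0 ≤ C * δ ^ 2 := by positivity
    nlinarith
  have h8 : 4 * C * (16 * c ^ 2) < 1 := by
    rw [hc, div_pow, mul_pow, one_pow, mul_one_div, mul_div_assoc', div_lt_one (by positivity)]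
    nlinarith
  nlinarith [mul_le_mul_of_nonneg_left h6 (by positivity : 0 ≤ 4 * C)]

end Geometry

/-! ### The standard quantum limit -/

section StandardQuantumLimit

variable {a b V : Type*} [Fintype a]

open scoped MatrixOrder Matrix.Norms.L2Operator in
/-- Quantum states span the space of all operators. -/
theorem span_isState : Submodule.span ℂ {ρ : Matrix a a ℂ | IsState ρ} = ⊤ := by
  classical
  rw [eq_top_iff, ← CStarAlgebra.span_nonneg, Submodule.span_le]
  intro X hX
  have hX' : X.PosSemidef := Matrix.nonneg_iff_posSemidef.1 hX
  by_cases h : X.trace = 0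
  · rw [hX'.trace_eq_zero_iff.1 h]
    exact Submodule.zero_mem _
  · have hstate : IsState ((X.trace)⁻¹ • X) := by
      refine ⟨hX'.smul ?_, by rw [Matrix.trace_smul, smul_eq_mul, inv_mul_cancel₀ h]⟩
      obtain ⟨t, ht₀, ht⟩ := RCLike.nonneg_iff_exists_ofReal.1 hX'.trace_nonneg
      rw [← ht]
      change (0 : ℂ) ≤ (Complex.ofReal t)⁻¹
      rw [← Complex.ofReal_inv, Complex.zero_le_real]
      exact inv_nonneg.2 ht₀
    have h2 := Submodule.smul_mem _ X.trace (Submodule.subset_span hstate :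
      _ ∈ Submodule.span ℂ {ρ : Matrix a a ℂ | IsState ρ})
    rwa [smul_smul, mul_inv_cancel₀ h, one_smul] at h2

theorem differentiableOn_of_isState [NormedAddCommGroup V] [NormedSpace ℝ V] {Θ : Set V}
    {E : V → SuperOp a b}
    (h : ∀ ρ, IsState ρ → ∀ i j, DifferentiableOn ℝ (fun θ => E θ ρ i j) Θ)
    (X : Matrix a a ℂ) (i j : b) : DifferentiableOn ℝ (fun θ => E θ X i j) Θ := by
  have hX : X ∈ Submodule.span ℂ {ρ : Matrix a a ℂ | IsState ρ} := by
    rw [span_isState]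
    trivial
  induction hX using Submodule.span_induction with
  | mem ρ hρ => exact h ρ hρ i j
  | zero => simp
  | add X Y _ _ hX hY => exact (hX.add hY).congr fun θ _ => by simp
  | smul c X _ hX => exact (hX.const_mul c).congr fun θ _ => by simp

variable [Fintype b]

theorem noisy_isChannel [DecidableEq a] {ε : ℝ} (hε₀ : 0 ≤ ε) (hε₁ : ε ≤ 1) {ρ₀ : Matrix b b ℂ}
    (hρ₀ : IsState ρ₀) {U : SuperOp a b} (hU : IsChannel U) : IsChannel (noisy ε ρ₀ U) := by
  have h : noisy ε ρ₀ U = SuperOp.ofChoi ((ε : ℂ) • (ρ₀ ⊗ₖ (1 : Matrix a a ℂ)) +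
      ((1 - ε : ℝ) : ℂ) • U.choi) := by
    refine LinearMap.ext fun X => ?_
    conv_lhs => rw [← U.ofChoi_choi]
    ext p q
    simp only [noisy, LinearMap.add_apply, LinearMap.smul_apply, LinearMap.smulRight_apply,
      Matrix.add_apply, Matrix.smul_apply, SuperOp.ofChoi_apply, Matrix.traceLinearMap_apply,
      Matrix.kroneckerMap_apply, smul_eq_mul, add_mul, Finset.sum_add_distrib, Matrix.one_apply,
      Matrix.trace, Matrix.diag_apply]
    congr 1
    · simp only [mul_ite, mul_one, mul_zero, ite_mul, zero_mul, Finset.sum_ite_eq, Finset.mem_univ,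
        if_true, Finset.sum_mul, Finset.mul_sum]
      exact Finset.sum_congr rfl fun i _ => by ring
    · simp only [Finset.mul_sum, mul_assoc]
  rw [h]
  refine IsChannel.of_choi (((hρ₀.1.kronecker .one).smul ?_).add (hU.1.choi_posSemidef.smul ?_))
    fun i j => ?_
  · rwa [Complex.zero_le_real]
  · rw [Complex.zero_le_real]
    linarith
  · simp only [Matrix.add_apply, Matrix.smul_apply, Matrix.kroneckerMap_apply, smul_eq_mul,
      Finset.sum_add_distrib, ← Finset.mul_sum, hU.sum_choi_apply, Matrix.one_apply]
    have htr : ∑ p, ρ₀ p p = 1 := hρ₀.2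
    split_ifs
    · simp only [mul_one, htr]
      push_cast
      ring
    · simp

/-- The Choi matrix of the noiseless part of a noisy channel. -/
noncomputable def noiselessChoi [DecidableEq a] (ε : ℝ) (U : SuperOp a b) :
    Matrix (b × a) (b × a) ℂ :=
  ((1 - ε : ℝ) : ℂ) • U.choi

theorem noiselessChoi_posSemidef [DecidableEq a] {ε : ℝ} (hε₁ : ε ≤ 1) {U : SuperOp a b}
    (hU : IsChannel U) : (noiselessChoi ε U).PosSemidef := by
  refine hU.1.choi_posSemidef.smul ?_
  rw [Complex.zero_le_real]
  linarith

/-- The nonzero eigenvalues of `A` are at least `κ`. -/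
def HasSpectralGap {n : Type*} [Fintype n] [DecidableEq n] (A : Matrix n n ℂ) (κ : ℝ) : Prop :=
  ∀ h : A.IsHermitian, ∀ i, h.eigenvalues i = 0 ∨ κ ≤ h.eigenvalues i

/-- The quantitative standard quantum limit for two noisy channels. -/
theorem EstimationProtocol.one_sub_mul_norm_sub_le_rmse_add_rmse [DecidableEq a] [DecidableEq b]
    [NormedAddCommGroup V]
    {ε : ℝ} (hε₀ : 0 < ε) (hε₁ : ε ≤ 1) {ρ₀ : Matrix b b ℂ} (hρ₀ : IsState ρ₀)
    {U U' : SuperOp a b} (hU : IsChannel U) (hU' : IsChannel U') {κ : ℝ} (hκ : 0 < κ)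
    (hg : HasSpectralGap (noiselessChoi ε U) κ) (hg' : HasSpectralGap (noiselessChoi ε U') κ)
    {η : ℝ} (hη₁ : η ≤ ε)
    (hη : (ε + Fintype.card a) / (κ * ε) *
      ∑ x, ∑ y, ‖noiselessChoi ε U x y - noiselessChoi ε U' x y‖ ^ 2 ≤ η)
    {N : ℕ} (P : EstimationProtocol a b V N) (θ θ' : V) :
    (1 - N * η) * ‖θ - θ'‖ ≤ P.rmse (noisy ε ρ₀ U) θ + P.rmse (noisy ε ρ₀ U') θ' := by
  have hA := noiselessChoi_posSemidef hε₁ hU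
  have hB := noiselessChoi_posSemidef hε₁ hU'
  have hη₀ : 0 ≤ η := le_trans (by positivity) hη
  let R : Fin 2 → Matrix (b × a) (b × a) ℂ :=
    ![hA.isHermitian.spectralSqrt, hB.isHermitian.spectralSqrt]
  have hR0 : R 0 * R 0 = noiselessChoi ε U := hA.spectralSqrt_mul_self
  have hR1 : R 1 * R 1 = noiselessChoi ε U' := hB.spectralSqrt_mul_self
  have hptr : ∀ {W : SuperOp a b}, IsChannel W →
      ptraceFst (noiselessChoi ε W) = ((1 - ε : ℝ) : ℂ) • 1 := by
    intro W hW
    ext i j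
    simp only [ptraceFst, noiselessChoi, Matrix.of_apply, Matrix.smul_apply, smul_eq_mul,
      ← Finset.mul_sum, hW.sum_choi_apply, Matrix.one_apply]
  have hsqrt := sum_norm_spectralSqrt_sub_sq_le hA hB (hg _) (hg' _)
  obtain ⟨J, hJ, hJs, hJ01⟩ := exists_choi_coupling hε₀ hρ₀ R
    (Fin.forall_fin_two.2 ⟨hA.isHermitian.isHermitian_spectralSqrt,
      hB.isHermitian.isHermitian_spectralSqrt⟩)
    (Fin.forall_fin_two.2 ⟨hR0 ▸ hptr hU, hR1 ▸ hptr hU'⟩) hη₀ hη₁ (by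
      change _ * ∑ x, ∑ y,
        ‖hA.isHermitian.spectralSqrt x y - hB.isHermitian.spectralSqrt x y‖ ^ 2 ≤ _
      rw [div_mul_eq_mul_div, div_le_iff₀ (by positivity)] at hη
      have h2 : (0 : ℝ) ≤ ε + Fintype.card a := by positivity
      have h3 := (mul_le_mul_of_nonneg_left hsqrt h2).trans hη
      refine le_of_mul_le_mul_left ?_ hκ
      linarith)
  have hnoisy : ∀ W : SuperOp a b, SuperOp.ofChoi (noiselessChoi ε W) +
      (ε : ℂ) • (Matrix.traceLinearMap a ℂ ℂ).smulRight ρ₀ = noisy ε ρ₀ W := by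
    intro W
    rw [noisy, add_comm]
    congr 1
    conv_rhs => rw [← W.ofChoi_choi]
    refine LinearMap.ext fun X => ?_
    ext p q
    simp [SuperOp.ofChoi_apply, noiselessChoi, Finset.mul_sum, mul_assoc]
  have hfid := P.pow_le_sum_sqrt_prob hJ ((hJs 0).trans (by rw [hR0, hnoisy]))
    ((hJs 1).trans (by rw [hR1, hnoisy])) hJ01
  refine le_trans (mul_le_mul_of_nonneg_right (le_trans ?_ hfid) (norm_nonneg _))
    (P.mul_norm_sub_le_rmse_add_rmse (noisy_isChannel hε₀.le hε₁ hρ₀ hU)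
      (noisy_isChannel hε₀.le hε₁ hρ₀ hU') θ θ')
  have := one_add_mul_le_pow (a := -η) (by linarith) N
  rw [← sub_eq_add_neg] at this
  linarith

/-- The parameters `θ` at which the noiseless Choi matrix has spectral gap `1 / (m + 1)` and is
`(m + 1)`-Lipschitz within distance `1 / (m + 1)`. -/
def regularSet [DecidableEq a] [DecidableEq b] [NormedAddCommGroup V] (ε : ℝ) (U : V → SuperOp a b)
    (Θ : Set V) (m : ℕ) : Set V :=
  {θ ∈ Θ | HasSpectralGap (noiselessChoi ε (U θ)) (1 / ((m : ℝ) + 1)) ∧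
    ∀ θ' ∈ Θ, ‖θ' - θ‖ < 1 / ((m : ℝ) + 1) →
      ∑ x, ∑ y, ‖noiselessChoi ε (U θ) x y - noiselessChoi ε (U θ') x y‖ ^ 2 ≤
        ((m : ℝ) + 1) * ‖θ - θ'‖ ^ 2}

/-- Differentiability at `θ` gives some Lipschitz constant at `θ`, and the finitely many nonzero
eigenvalues at `θ` have some gap, so every parameter is regular for large `m`. -/
theorem subset_iUnion_regularSet [DecidableEq a] [DecidableEq b] [NormedAddCommGroup V]
    [NormedSpace ℝ V] {ε : ℝ} (hε₁ : ε ≤ 1) {Θ : Set V} {U : V → SuperOp a b}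
    (hU : ∀ θ ∈ Θ, IsChannel (U θ))
    (hd : ∀ x y, DifferentiableOn ℝ (fun θ => noiselessChoi ε (U θ) x y) Θ) :
    Θ ⊆ ⋃ m, regularSet ε U Θ m := by
  intro θ hθ
  have hpsd := noiselessChoi_posSemidef hε₁ (hU θ hθ)
  obtain ⟨κ, hκ, hκ'⟩ := hpsd.exists_gap
  have hO : ∀ x y, ∃ c : ℝ, ∀ᶠ θ' in 𝓝[Θ] θ,
      ‖noiselessChoi ε (U θ') x y - noiselessChoi ε (U θ) x y‖ ≤ c * ‖θ' - θ‖ :=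
    fun x y => (hd x y θ hθ).isBigO_sub.bound
  choose c hc using hO
  have hev : ∀ᶠ θ' in 𝓝[Θ] θ, ∀ x y,
      ‖noiselessChoi ε (U θ') x y - noiselessChoi ε (U θ) x y‖ ≤ c x y * ‖θ' - θ‖ :=
    eventually_all.2 fun x => eventually_all.2 fun y => hc x y
  obtain ⟨r, hr, hr'⟩ := Metric.mem_nhdsWithin_iff.1 hev
  obtain ⟨m, hm⟩ := exists_nat_ge (max (1 / κ) (max (1 / r) (∑ x, ∑ y, c x y ^ 2)))
  have hm1 : 1 / κ ≤ m := (le_max_left _ _).trans hm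
  have hm2 : 1 / r ≤ m := (le_max_left _ _).trans ((le_max_right _ _).trans hm)
  have hm3 : ∑ x, ∑ y, c x y ^ 2 ≤ m := (le_max_right _ _).trans ((le_max_right _ _).trans hm)
  have hm0 : (0 : ℝ) < m + 1 := by positivity
  refine Set.mem_iUnion.2 ⟨m, hθ, fun h i => (hκ' i).imp_right fun hi => le_trans ?_ hi,
    fun θ' hθ' hlt => ?_⟩
  · exact (one_div_le hm0 hκ).2 (by linarith)
  · have hball : θ' ∈ Metric.ball θ r := by
      rw [Metric.mem_ball, dist_eq_norm]
      exact hlt.trans_le ((one_div_le hm0 hr).2 (by linarith))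
    have hb := hr' ⟨hball, hθ'⟩
    calc _ ≤ ∑ x, ∑ y, c x y ^ 2 * ‖θ - θ'‖ ^ 2 := by
          refine Finset.sum_le_sum fun x _ => Finset.sum_le_sum fun y _ => ?_
          rw [← mul_pow, norm_sub_rev, norm_sub_rev θ]
          exact pow_le_pow_left₀ (norm_nonneg _) (hb x y) 2
      _ = (∑ x, ∑ y, c x y ^ 2) * ‖θ - θ'‖ ^ 2 := by simp only [Finset.sum_mul]
      _ ≤ _ := by
          gcongr
          linarith

/-- On a set of regular parameters, two nearby parameters cannot both be estimated well. -/
theorem EstimationProtocol.le_rmse_add_rmse_of_mem_regularSet [DecidableEq a] [DecidableEq b]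
    [NormedAddCommGroup V] {ε : ℝ} (hε₀ : 0 < ε) (hε₁ : ε ≤ 1) {ρ₀ : Matrix b b ℂ}
    (hρ₀ : IsState ρ₀) {Θ : Set V} {U : V → SuperOp a b} (hU : ∀ θ ∈ Θ, IsChannel (U θ)) (m : ℕ) :
    ∃ C r : ℝ, 0 < C ∧ 0 < r ∧ ∀ (N : ℕ) (P : EstimationProtocol a b V N),
      ∀ θ ∈ regularSet ε U Θ m, ∀ θ' ∈ regularSet ε U Θ m, ‖θ - θ'‖ < r →
        (1 - N * (C * ‖θ - θ'‖ ^ 2)) * ‖θ - θ'‖ ≤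
          P.rmse (noisy ε ρ₀ (U θ)) θ + P.rmse (noisy ε ρ₀ (U θ')) θ' := by
  have hm0 : (0 : ℝ) < m + 1 := by positivity
  set C := (ε + Fintype.card a) / (1 / ((m : ℝ) + 1) * ε) * (m + 1) with hC
  have hC₀ : 0 < C := by positivity
  refine ⟨C, min (1 / ((m : ℝ) + 1)) (min 1 (ε / C)), hC₀, by positivity,
    fun N P θ hθ θ' hθ' hlt => ?_⟩
  have h1 : ‖θ - θ'‖ < 1 / ((m : ℝ) + 1) := hlt.trans_le (min_le_left _ _)
  have h2 : ‖θ - θ'‖ < 1 := hlt.trans_le ((min_le_right _ _).trans (min_le_left _ _))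
  have h3 : ‖θ - θ'‖ < ε / C := hlt.trans_le ((min_le_right _ _).trans (min_le_right _ _))
  have h0 := norm_nonneg (θ - θ')
  refine P.one_sub_mul_norm_sub_le_rmse_add_rmse hε₀ hε₁ hρ₀ (hU θ hθ.1) (hU θ' hθ'.1)
    (one_div_pos.2 hm0) hθ.2.1 hθ'.2.1 ?_ ?_ θ θ'
  · rw [lt_div_iff₀ hC₀] at h3
    nlinarith
  · rw [hC, mul_assoc]
    refine mul_le_mul_of_nonneg_left (hθ.2.2 θ' hθ'.1 ?_) (by positivity)
    rwa [norm_sub_rev]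

end StandardQuantumLimit

/-! ### Lower bounds for differentiable families -/

section DifferentiableFamily

variable {a b V : Type*} [Fintype a]

theorem differentiableOn_noiselessChoi [DecidableEq a] [NormedAddCommGroup V] [NormedSpace ℝ V]
    {ε : ℝ} {ρ₀ : Matrix b b ℂ} {Θ : Set V} {U : V → SuperOp a b}
    (hd : ∀ ρ, IsState ρ → ∀ i j, DifferentiableOn ℝ (fun θ => noisy ε ρ₀ (U θ) ρ i j) Θ)
    (x y : b × a) : DifferentiableOn ℝ (fun θ => noiselessChoi ε (U θ) x y) Θ := by
  have h := differentiableOn_of_isState hd (Matrix.single x.2 y.2 1) x.1 y.1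
  refine (h.sub_const ((ε : ℂ) * ((Matrix.single x.2 y.2 (1 : ℂ)).trace * ρ₀ x.1 y.1))).congr
    fun θ _ => ?_
  simp [noisy, noiselessChoi, SuperOp.choi]

variable [Fintype b]

theorem exists_le_rmse [NormedAddCommGroup V] [NormedSpace ℝ V] [FiniteDimensional ℝ V]
    [Nontrivial V] [MeasurableSpace V] [BorelSpace V] (μ : Measure V) [μ.IsAddHaarMeasure]
    {ε : ℝ} (hε₀ : 0 < ε) (hε₁ : ε ≤ 1) {ρ₀ : Matrix b b ℂ} (hρ₀ : IsState ρ₀)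
    {Θ : Set V} {U : V → SuperOp a b} (hΘ : (interior Θ).Nonempty)
    (hU : ∀ θ ∈ Θ, IsChannel (U θ))
    (hd : ∀ ρ, IsState ρ → ∀ i j, DifferentiableOn ℝ (fun θ => noisy ε ρ₀ (U θ) ρ i j) Θ) :
    ∃ c : ℝ, 0 < c ∧ ∀ N : ℕ, 0 < N → ∀ P : EstimationProtocol a b V N,
      ∃ θ ∈ Θ, c / √(N : ℝ) ≤ P.rmse (noisy ε ρ₀ (U θ)) θ := by
  classical
  have hcover := subset_iUnion_regularSet hε₁ hU (differentiableOn_noiselessChoi hd)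
  obtain ⟨m, hm⟩ : ∃ m, μ (regularSet ε U Θ m) ≠ 0 := by
    by_contra h
    push Not at h
    exact (Measure.measure_pos_of_nonempty_interior μ hΘ).ne'
      (measure_mono_null hcover (measure_iUnion_null h))
  obtain ⟨C, r, hC, hr, hpair⟩ :=
    EstimationProtocol.le_rmse_add_rmse_of_mem_regularSet hε₀ hε₁ hρ₀ hU m
  obtain ⟨r₀, hr₀, hdist⟩ := exists_pairs_of_measure_ne_zero μ hm
  -- at distance of order `s / √N` the fidelity of the outcome distributions is at least `1 / 2`
  set s := min r₀ (min (r / 4) (min 1 (1 / (8 * C)))) with hs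
  have hs₀ : 0 < s := by positivity
  have hs1 : s ≤ r₀ := min_le_left _ _
  have hs2 : s ≤ r / 4 := (min_le_right _ _).trans (min_le_left _ _)
  have hs3 : s ≤ 1 := (min_le_right _ _).trans ((min_le_right _ _).trans (min_le_left _ _))
  have hs4 : s ≤ 1 / (8 * C) :=
    (min_le_right _ _).trans ((min_le_right _ _).trans (min_le_right _ _))
  refine ⟨s / 16, by positivity, fun N hN P => ?_⟩
  have hN1 : (1 : ℝ) ≤ N := by exact_mod_cast hN
  have hsN : 1 ≤ √(N : ℝ) := Real.one_le_sqrt.2 hN1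
  have hsN₀ : 0 < √(N : ℝ) := by linarith
  have hsle : s / √(N : ℝ) ≤ s := div_le_self hs₀.le hsN
  obtain ⟨θ, hθ, θ', hθ', h1, h2⟩ := hdist (s / √(N : ℝ)) (by positivity) (hsle.trans hs1)
  have h3 := hpair N P θ hθ θ' hθ' (by linarith)
  have h4 : (N : ℝ) * (C * ‖θ - θ'‖ ^ 2) ≤ 1 / 2 := by
    calc (N : ℝ) * (C * ‖θ - θ'‖ ^ 2) ≤ N * (C * (2 * (s / √(N : ℝ))) ^ 2) := by gcongr
      _ = 4 * C * s ^ 2 := by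
          rw [mul_pow, div_pow, Real.sq_sqrt (by positivity)]
          field_simp
          ring
      _ ≤ 4 * C * s := by
          have : s ^ 2 ≤ s := by nlinarith
          gcongr
      _ ≤ 1 / 2 := by
          rw [le_div_iff₀ (by positivity)] at hs4
          linarith
  have h5 : ‖θ - θ'‖ / 2 ≤ P.rmse (noisy ε ρ₀ (U θ)) θ + P.rmse (noisy ε ρ₀ (U θ')) θ' := by
    refine le_trans ?_ h3
    have := norm_nonneg (θ - θ')
    nlinarith
  have h6 : s / 16 / √(N : ℝ) = s / √(N : ℝ) / 16 := by ring
  by_contra hno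
  push Not at hno
  have h7 := hno θ hθ.1
  have h8 := hno θ' hθ'.1
  rw [h6] at h7 h8
  linarith

theorem ae_not_isLittleO_rmse [NormedAddCommGroup V] [NormedSpace ℝ V] [FiniteDimensional ℝ V]
    [Nontrivial V] [MeasurableSpace V] [BorelSpace V] (μ : Measure V) [μ.IsAddHaarMeasure]
    {ε : ℝ} (hε₀ : 0 < ε) (hε₁ : ε ≤ 1) {ρ₀ : Matrix b b ℂ} (hρ₀ : IsState ρ₀)
    {Θ : Set V} {U : V → SuperOp a b} (hU : ∀ θ ∈ Θ, IsChannel (U θ))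
    (hd : ∀ ρ, IsState ρ → ∀ i j, DifferentiableOn ℝ (fun θ => noisy ε ρ₀ (U θ) ρ i j) Θ)
    (P : ∀ N : ℕ, EstimationProtocol a b V N) :
    ∀ᵐ θ ∂μ, θ ∈ Θ → ¬ (fun N => (P N).rmse (noisy ε ρ₀ (U θ)) θ) =o[atTop]
      (fun N : ℕ => 1 / √(N : ℝ)) := by
  classical
  have hcover := subset_iUnion_regularSet hε₁ hU (differentiableOn_noiselessChoi hd)
  have hcount : (⋃ m, {θ ∈ regularSet ε U Θ m | (fun N => (P N).rmse (noisy ε ρ₀ (U θ)) θ) =o[atTop]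
      (fun N : ℕ => 1 / √(N : ℝ))}).Countable := by
    refine Set.countable_iUnion fun m => ?_
    obtain ⟨C, r, hC, hr, hpair⟩ :=
      EstimationProtocol.le_rmse_add_rmse_of_mem_regularSet hε₀ hε₁ hρ₀ hU m
    exact countable_setOf_isLittleO hC hr (fun N θ => (P N).rmse (noisy ε ρ₀ (U θ)) θ)
      fun N => hpair N (P N)
  filter_upwards [hcount.ae_notMem μ] with θ hθ hmem ho
  obtain ⟨m, hm⟩ := Set.mem_iUnion.1 (hcover hmem)
  exact hθ (Set.mem_iUnion.2 ⟨m, hm, ho⟩)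

end DifferentiableFamily

/-! ### Operators of port-based teleportation -/

section Ports

/-- Replacing one coordinate by an independent uniform one does not change averages. -/
theorem sum_sum_update {a : Type*} [Fintype a] {N : ℕ} (g : (Fin N → a) → ℂ) (j : Fin N) :
    ∑ r, ∑ y, g (Function.update r j y) = Fintype.card a * ∑ r, g r := by
  let e : (Fin N → a) × a → (Fin N → a) × a := fun z => (Function.update z.1 j z.2, z.1 j)
  have he : Function.Involutive e := fun z => by simp [e]
  have h := Equiv.sum_comp he.toPerm (fun z : (Fin N → a) × a => g z.1)
  simp only [Function.Involutive.coe_toPerm, Fintype.sum_prod_type, e] at h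
  rw [h]
  simp [Finset.mul_sum]

variable {a : Type*} [DecidableEq a] {N : ℕ}

/-- The operator `|Ω⟩⟨Ω|` for the unnormalized maximally entangled vector `Ω` of the `i`-th of `N`
ports and the input system, which is the second factor. -/
def portProj (a : Type*) [DecidableEq a] {N : ℕ} (i : Fin N) :
    Matrix ((Fin N → a) × a) ((Fin N → a) × a) ℂ :=
  Matrix.of fun u v => if u.1 i = u.2 ∧ v.1 = Function.update u.1 i v.2 then 1 else 0

/-- The operator that swaps the ports `j` and `k`. -/
def portSwap (a : Type*) [DecidableEq a] {N : ℕ} (j k : Fin N) :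
    Matrix ((Fin N → a) × a) ((Fin N → a) × a) ℂ :=
  Matrix.of fun u v => if v = (u.1 ∘ Equiv.swap j k, u.2) then 1 else 0

theorem isHermitian_portProj (i : Fin N) : (portProj a i).IsHermitian := by
  ext u v
  have h : (v.1 i = v.2 ∧ u.1 = Function.update v.1 i u.2) ↔
      (u.1 i = u.2 ∧ v.1 = Function.update u.1 i v.2) := by
    constructor <;> rintro ⟨h1, h2⟩ <;> refine ⟨by simp [h2], ?_⟩ <;> rw [h2, ← h1] <;> simp
  simp [portProj, h]

theorem isHermitian_portSwap (j k : Fin N) : (portSwap a j k).IsHermitian := by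
  ext u v
  have h : u = (v.1 ∘ Equiv.swap j k, v.2) ↔ v = (u.1 ∘ Equiv.swap j k, u.2) := by
    constructor <;> rintro h <;> rw [h] <;> ext <;> simp
  simp [portSwap, h]

theorem portSwap_comm (j k : Fin N) : portSwap a j k = portSwap a k j := by
  rw [portSwap, portSwap, Equiv.swap_comm]

/-- The sum of the `portProj` over all ports. -/
def portSum (a : Type*) [DecidableEq a] (N : ℕ) :
    Matrix ((Fin N → a) × a) ((Fin N → a) × a) ℂ :=
  ∑ i, portProj a i

/-- The sum of all swaps of two ports, over all ordered pairs of ports. Up to a shift, this is the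
quadratic Casimir operator of the unitary group acting on the ports. -/
def swapSum (a : Type*) [DecidableEq a] (N : ℕ) :
    Matrix ((Fin N → a) × a) ((Fin N → a) × a) ℂ :=
  ∑ j, ∑ k, portSwap a j k

theorem isHermitian_portSum : (portSum a N).IsHermitian := by
  rw [Matrix.IsHermitian, portSum, Matrix.conjTranspose_sum]
  exact Finset.sum_congr rfl fun i _ => isHermitian_portProj i

variable [Fintype a]

theorem portProj_mulVec (i : Fin N) (f : (Fin N → a) × a → ℂ) (u : (Fin N → a) × a) :
    (portProj a i *ᵥ f) u = if u.1 i = u.2 then ∑ y, f (Function.update u.1 i y, y) else 0 := by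
  simp only [Matrix.mulVec, dotProduct, portProj, Matrix.of_apply, Fintype.sum_prod_type, ite_and,
    ite_mul, one_mul, zero_mul]
  split_ifs
  · rw [Finset.sum_comm]
    simp
  · simp

theorem portSwap_mulVec (j k : Fin N) (f : (Fin N → a) × a → ℂ) (u : (Fin N → a) × a) :
    (portSwap a j k *ᵥ f) u = f (u.1 ∘ Equiv.swap j k, u.2) := by
  simp [Matrix.mulVec, dotProduct, portSwap]

theorem Matrix.ext_mulVec {m n : Type*} [Fintype n] [DecidableEq n] {A B : Matrix m n ℂ}
    (h : ∀ f u, (A *ᵥ f) u = (B *ᵥ f) u) : A = B :=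
  Matrix.mulVec_injective (funext fun f => funext fun u => h f u)

theorem portProj_mul_self (i : Fin N) :
    portProj a i * portProj a i = (Fintype.card a : ℂ) • portProj a i := by
  refine Matrix.ext_mulVec fun f u => ?_
  rw [← Matrix.mulVec_mulVec, portProj_mulVec, Matrix.smul_mulVec, Pi.smul_apply, portProj_mulVec]
  simp [portProj_mulVec]

theorem portSwap_mul_portProj_of_ne {i j : Fin N} (h : j ≠ i) :
    portSwap a i j * portProj a i = portProj a j * portProj a i := by
  refine Matrix.ext_mulVec fun f u => ?_
  rw [← Matrix.mulVec_mulVec, ← Matrix.mulVec_mulVec, portSwap_mulVec, portProj_mulVec,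
    portProj_mulVec]
  simp only [portProj_mulVec, Function.comp_apply, Equiv.swap_apply_left,
    Function.update_of_ne h.symm, Finset.sum_ite_eq, Finset.mem_univ, if_true]
  refine if_congr Iff.rfl (Finset.sum_congr rfl fun y _ => ?_) rfl
  congr 2
  ext l
  by_cases hl : l = i
  · simp [hl]
  · by_cases hl' : l = j
    · subst hl'
      simp [Function.update_of_ne hl]
    · simp [Function.update_of_ne hl, Function.update_of_ne hl',
        Equiv.swap_apply_of_ne_of_ne hl hl']

theorem portSwap_mul_portProj (i j k : Fin N) :
    portSwap a j k * portProj a i = portProj a (Equiv.swap j k i) * portSwap a j k := by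
  refine Matrix.ext_mulVec fun f u => ?_
  rw [← Matrix.mulVec_mulVec, ← Matrix.mulVec_mulVec, portSwap_mulVec, portProj_mulVec,
    portProj_mulVec]
  refine if_congr Iff.rfl (Finset.sum_congr rfl fun y _ => ?_) rfl
  rw [portSwap_mulVec]
  congr 2
  ext l
  by_cases hl : l = i
  · simp [hl]
  · have : Equiv.swap j k l ≠ Equiv.swap j k i := fun h => hl ((Equiv.swap j k).injective h)
    simp [Function.update_of_ne hl, Function.update_of_ne this]

theorem portSwap_self (i : Fin N) : portSwap a i i = 1 := by
  refine Matrix.ext_mulVec fun f u => ?_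
  rw [portSwap_mulVec]
  simp

theorem posSemidef_portProj [Nonempty a] (i : Fin N) : (portProj a i).PosSemidef := by
  have h := (Matrix.posSemidef_conjTranspose_mul_self (portProj a i)).smul
    (a := (((Fintype.card a : ℝ)⁻¹ : ℝ) : ℂ)) (by rw [Complex.zero_le_real]; positivity)
  rw [isHermitian_portProj, portProj_mul_self, smul_smul] at h
  have e : (((Fintype.card a : ℝ)⁻¹ : ℝ) : ℂ) * (Fintype.card a : ℂ) = 1 := by
    have : (Fintype.card a : ℂ) ≠ 0 := by exact_mod_cast Fintype.card_ne_zero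
    push_cast
    exact inv_mul_cancel₀ this
  rwa [e, one_smul] at h

/-- Up to a shift, `swapSum - 2 • portSum` is the quadratic Casimir operator of the unitary group
acting on the ports and, dually, on the input. Since `Ω` is invariant, it commutes with the
projections on `Ω`. -/
theorem commute_swapSum_sub_portProj (i : Fin N) :
    Commute (swapSum a N - (2 : ℂ) • portSum a N) (portProj a i) := by
  have hadj : ∀ {j : Fin N}, j ≠ i →
      portProj a i * portSwap a i j = portProj a i * portProj a j := by
    intro j hj
    have h := congrArg Matrix.conjTranspose (portSwap_mul_portProj_of_ne (a := a) hj)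
    simpa only [Matrix.conjTranspose_mul, (isHermitian_portProj _).eq,
      (isHermitian_portSwap _ _).eq] using h
  have key : ∀ j k, portSwap a j k * portProj a i - portProj a i * portSwap a j k =
      (if j = i then portProj a k * portProj a i - portProj a i * portProj a k else 0) +
      (if k = i then portProj a j * portProj a i - portProj a i * portProj a j else 0) := by
    intro j k
    by_cases hj : j = i
    · subst hj
      by_cases hk : k = j
      · subst hk
        simp [portSwap_self]
      · rw [portSwap_mul_portProj_of_ne hk, hadj hk]
        simp [hk]
    · by_cases hk : k = i
      · subst hk
        rw [portSwap_comm, portSwap_mul_portProj_of_ne hj, hadj hj]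
        simp [hj]
      · rw [portSwap_mul_portProj, Equiv.swap_apply_of_ne_of_ne (Ne.symm hj) (Ne.symm hk)]
        simp [hj, hk]
  have hsum : swapSum a N * portProj a i - portProj a i * swapSum a N =
      (2 : ℂ) • (portSum a N * portProj a i - portProj a i * portSum a N) := by
    simp only [swapSum, portSum, Finset.sum_mul, Finset.mul_sum, ← Finset.sum_sub_distrib, key,
      Finset.sum_add_distrib]
    rw [Finset.sum_comm]
    simp [two_smul]
  rw [Commute, SemiconjBy, Matrix.sub_mul, Matrix.mul_sub, Matrix.smul_mul, Matrix.mul_smul,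
    ← sub_eq_zero]
  rw [smul_sub, sub_eq_iff_eq_add] at hsum
  rw [hsum]
  abel

/-- Tracing out the input system, and tensoring with the identity of it. -/
def traceOutInput {X : Type*} : Matrix (X × a) (X × a) ℂ →ₗ[ℂ] Matrix (X × a) (X × a) ℂ where
  toFun Z := (Matrix.of fun x y => ∑ i, Z (x, i) (y, i)) ⊗ₖ (1 : Matrix a a ℂ)
  map_add' Y Z := by
    ext u v
    simp [Finset.sum_add_distrib, add_mul]
  map_smul' c Z := by
    ext u v
    simp [← Finset.mul_sum, mul_assoc]

theorem traceOutInput_apply {X : Type*} (Z : Matrix (X × a) (X × a) ℂ) (u v : X × a) :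
    traceOutInput Z u v = (∑ i, Z (u.1, i) (v.1, i)) * (1 : Matrix a a ℂ) u.2 v.2 := rfl

theorem trace_traceOutInput {X : Type*} [Fintype X] (Z : Matrix (X × a) (X × a) ℂ) :
    (traceOutInput Z).trace = Fintype.card a * Z.trace := by
  simp only [Matrix.trace, Matrix.diag_apply, traceOutInput_apply, Matrix.one_apply_eq, mul_one,
    Fintype.sum_prod_type, Finset.sum_const, Finset.card_univ, nsmul_eq_mul, Finset.mul_sum]

theorem traceOutInput_one {X : Type*} [DecidableEq X] :
    traceOutInput (1 : Matrix (X × a) (X × a) ℂ) = (Fintype.card a : ℂ) • 1 := by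
  ext ⟨x, i⟩ ⟨y, j⟩
  simp only [traceOutInput_apply, Matrix.one_apply, Prod.mk.injEq, Matrix.smul_apply]
  by_cases hx : x = y <;> simp [hx]

theorem traceOutInput_portSwap_mul_portProj (i j k : Fin N) :
    traceOutInput (portSwap a j k * portProj a i) = portSwap a j k := by
  have hentry : ∀ u v, (portSwap a j k * portProj a i) u v =
      portProj a i (u.1 ∘ Equiv.swap j k, u.2) v := fun u v => by
    simp [Matrix.mul_apply, portSwap]
  ext ⟨r, x⟩ ⟨r', x'⟩
  simp only [traceOutInput_apply, hentry]
  simp only [portProj, Matrix.of_apply, ite_and, Finset.sum_ite_eq, Finset.mem_univ, if_true,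
    portSwap, Matrix.one_apply, Prod.mk.injEq, Function.update_eq_self]
  by_cases h : x = x' <;> simp [h, eq_comm]

theorem traceOutInput_portProj (i : Fin N) : traceOutInput (portProj a i) = 1 := by
  have h := traceOutInput_portSwap_mul_portProj (a := a) i i i
  rwa [portSwap_self, Matrix.one_mul] at h

theorem traceOutInput_portProj_mul_portProj (i j : Fin N) :
    traceOutInput (portProj a i * portProj a j) =
      portSwap a i j + if i = j then ((Fintype.card a : ℂ) - 1) • 1 else 0 := by
  by_cases h : i = j
  · subst h
    rw [portProj_mul_self, map_smul, traceOutInput_portProj, portSwap_self]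
    simp [sub_smul]
  · rw [← portSwap_mul_portProj_of_ne h, traceOutInput_portSwap_mul_portProj, portSwap_comm]
    simp [h]

theorem traceOutInput_portSum_sq :
    traceOutInput (portSum a N * portSum a N) =
      swapSum a N + ((N : ℂ) * ((Fintype.card a : ℂ) - 1)) • 1 := by
  simp only [portSum, Finset.sum_mul, Finset.mul_sum, map_sum, traceOutInput_portProj_mul_portProj,
    Finset.sum_add_distrib, swapSum]
  rw [Finset.sum_comm]
  simp [← Nat.cast_smul_eq_nsmul ℂ, smul_smul]

theorem traceOutInput_portSum : traceOutInput (portSum a N) = (N : ℂ) • 1 := by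
  simp [portSum, traceOutInput_portProj, ← Nat.cast_smul_eq_nsmul ℂ]

theorem trace_portSwap_of_ne {j k : Fin N} (h : j ≠ k) :
    (portSwap a j k).trace = (Fintype.card a : ℂ) ^ N := by
  have h1 : (portSwap a j k).trace =
      Fintype.card a * ∑ r : Fin N → a, if r j = r k then (1 : ℂ) else 0 := by
    simp only [Matrix.trace, Matrix.diag_apply, portSwap, Matrix.of_apply, Fintype.sum_prod_type,
      Prod.mk.injEq, and_true, Finset.sum_const, Finset.card_univ, nsmul_eq_mul, Finset.mul_sum]
    refine Finset.sum_congr rfl fun r _ => ?_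
    congr 1
    refine if_congr ⟨fun hr => by simpa using congrFun hr j, fun hr => ?_⟩ rfl rfl
    ext l
    by_cases hl : l = j
    · simp [hl, hr]
    · by_cases hl' : l = k
      · simp [hl', hr]
      · simp [Equiv.swap_apply_of_ne_of_ne hl hl']
  rw [h1, ← sum_sum_update _ j]
  simp [Function.update_of_ne h.symm]

theorem trace_swapSum : (swapSum a N).trace =
    (N : ℂ) * (Fintype.card a : ℂ) ^ (N + 1) +
      (N : ℂ) * ((N : ℂ) - 1) * (Fintype.card a : ℂ) ^ N := by
  have h : ∀ j k : Fin N, (portSwap a j k).trace = (Fintype.card a : ℂ) ^ N +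
      if j = k then (Fintype.card a : ℂ) ^ (N + 1) - (Fintype.card a : ℂ) ^ N else 0 := by
    intro j k
    by_cases hjk : j = k
    · subst hjk
      simp [portSwap_self, Matrix.trace_one, pow_succ]
    · simp [trace_portSwap_of_ne hjk, hjk]
  simp only [swapSum, Matrix.trace_sum, h, Finset.sum_add_distrib]
  simp
  ring

theorem trace_portSum [Nonempty a] :
    (portSum a N).trace = (N : ℂ) * (Fintype.card a : ℂ) ^ N := by
  have hd : (Fintype.card a : ℂ) ≠ 0 := by exact_mod_cast Fintype.card_ne_zero
  have h := trace_traceOutInput (portSum a N)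
  rw [traceOutInput_portSum, Matrix.trace_smul, Matrix.trace_one] at h
  refine mul_left_cancel₀ hd (h.symm.trans ?_)
  simp
  ring

theorem trace_swapSum_mul_portSum [Nonempty a] :
    (swapSum a N * portSum a N).trace = (N : ℂ) / Fintype.card a * (swapSum a N).trace := by
  have hd : (Fintype.card a : ℂ) ≠ 0 := by exact_mod_cast Fintype.card_ne_zero
  have h := trace_traceOutInput (swapSum a N * portSum a N)
  have e : traceOutInput (swapSum a N * portSum a N) = (N : ℂ) • swapSum a N := by
    simp only [portSum, swapSum, Finset.mul_sum, Finset.sum_mul, map_sum,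
      traceOutInput_portSwap_mul_portProj]
    simp [← Nat.cast_smul_eq_nsmul ℂ]
  rw [e, Matrix.trace_smul, smul_eq_mul] at h
  rw [div_mul_eq_mul_div, h]
  field_simp

end Ports

/-! ### A measurement that finds a port with high probability -/

section PortMeasurement

variable {a : Type*} [DecidableEq a] [Fintype a] {N : ℕ}

/-- An upper bound of `portSum` by an operator that commutes with every `portProj`: the square of
the deviation of `portSum` from its mean is bounded, by pinching, by the fluctuation of the Casimir
operator of the ports, which is then expressed by the Casimir operator of the ports and the
input. -/
theorem posSemidef_casimir_sub_portSum [Nonempty a] {κ : ℝ} (hκ : 0 < κ) :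
    ((((N / Fintype.card a + κ / 2 + Fintype.card a / (2 * κ) *
        (N * Fintype.card a - N - N ^ 2 / Fintype.card a) : ℝ) : ℂ) • 1 +
      ((Fintype.card a / (2 * κ) : ℝ) : ℂ) • (swapSum a N - (2 : ℂ) • portSum a N)) -
      ((1 - Fintype.card a / κ : ℝ) : ℂ) • portSum a N).PosSemidef := by
  set d : ℝ := (Fintype.card a : ℝ) with hd
  have hd₀ : 0 < d := by
    rw [hd]
    exact_mod_cast Fintype.card_pos
  have hdc : (d : ℂ) = Fintype.card a := by rw [hd]; norm_cast
  set T := portSum a N with hT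
  set m : ℝ := N / d with hm
  set Y := T - (m : ℂ) • 1 with hY
  have hYh : Yᴴ = Y := by
    rw [hY, Matrix.conjTranspose_sub, isHermitian_portSum.eq, Matrix.conjTranspose_smul,
      Matrix.conjTranspose_one, ← starRingEnd_apply, Complex.conj_ofReal]
  have hYY : Y * Y = T * T - (2 * m : ℂ) • T + (m ^ 2 : ℂ) • 1 := by
    rw [hY]
    simp only [Matrix.sub_mul, Matrix.mul_sub, Matrix.smul_mul, Matrix.mul_smul, Matrix.mul_one,
      Matrix.one_mul]
    module
  have hYt : traceOutInput (Y * Y) = swapSum a N + ((N * d - N - N ^ 2 / d : ℝ) : ℂ) • 1 := by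
    rw [hYY, map_add, map_sub, map_smul, map_smul, traceOutInput_portSum_sq, traceOutInput_portSum,
      traceOutInput_one, ← hdc, hm]
    have hdc0 : (d : ℂ) ≠ 0 := by exact_mod_cast hd₀.ne'
    rw [smul_smul, smul_smul, add_sub_assoc, add_assoc, ← sub_smul, ← add_smul]
    congr 2
    push_cast
    field_simp
    ring
  have hYpsd : (Y * Y).PosSemidef := by
    have h := Matrix.posSemidef_conjTranspose_mul_self Y
    rwa [hYh] at h
  have hpinch : ((d : ℂ) • traceOutInput (Y * Y) - Y * Y).PosSemidef := by
    rw [hdc]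
    exact hYpsd.card_smul_ptrace_kronecker_one_sub
  have hsq : ((Y - (κ : ℂ) • 1) * (Y - (κ : ℂ) • 1)).PosSemidef := by
    have h := Matrix.posSemidef_conjTranspose_mul_self (Y - (κ : ℂ) • 1)
    rwa [Matrix.conjTranspose_sub, hYh, Matrix.conjTranspose_smul, Matrix.conjTranspose_one,
      ← starRingEnd_apply, Complex.conj_ofReal] at h
  have hsq' : (Y - (κ : ℂ) • 1) * (Y - (κ : ℂ) • 1) =
      Y * Y - (2 * κ : ℂ) • Y + (κ ^ 2 : ℂ) • 1 := by
    simp only [Matrix.sub_mul, Matrix.mul_sub, Matrix.smul_mul, Matrix.mul_smul, Matrix.mul_one,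
      Matrix.one_mul]
    module
  rw [hsq'] at hsq
  have hfin := (hpinch.add hsq).smul (a := ((1 / (2 * κ) : ℝ) : ℂ))
    (by rw [Complex.zero_le_real]; positivity)
  rw [hYt] at hfin
  convert hfin using 1
  have hκc : (κ : ℂ) ≠ 0 := by exact_mod_cast hκ.ne'
  have e1 : (d : ℂ) / κ = (1 / (2 * κ)) * d * 2 := by field_simp
  have e2 : (κ : ℂ) / 2 = 1 / (2 * κ) * κ ^ 2 := by field_simp
  have e3 : (1 : ℂ) / (2 * κ) * (2 * κ) = 1 := by field_simp
  have e4 : (d : ℂ) / (2 * κ) = 1 / (2 * κ) * d := by field_simp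
  have e5 : ∀ Z : Matrix ((Fin N → a) × a) ((Fin N → a) × a) ℂ,
      (1 / (2 * κ) : ℂ) • ((2 * κ : ℂ) • Z) = Z := fun Z => by rw [smul_smul, e3, one_smul]
  push_cast
  rw [e1, e2, e4]
  generalize (N : ℂ) * d - N - N ^ 2 / d = w
  simp only [smul_add, smul_sub, e5]
  rw [hY]
  module

/-- The inverse is operator convex, hence bounded from below by its tangent at `t⁻¹`. -/
theorem Matrix.PosDef.posSemidef_inv_sub {n : Type*} [Fintype n] [DecidableEq n]
    {S : Matrix n n ℂ} (hS : S.PosDef) (t : ℝ) :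
    (S⁻¹ - ((2 * t : ℂ) • 1 - (t ^ 2 : ℂ) • S)).PosSemidef := by
  have h := hS.inv.posSemidef.conjTranspose_mul_mul_same (1 - (t : ℂ) • S)
  have hu := (Matrix.isUnit_iff_isUnit_det _).1 hS.isUnit
  have e : S⁻¹ - ((2 * t : ℂ) • 1 - (t ^ 2 : ℂ) • S) =
      (1 - (t : ℂ) • S)ᴴ * S⁻¹ * (1 - (t : ℂ) • S) := by
    rw [Matrix.conjTranspose_sub, Matrix.conjTranspose_smul, Matrix.conjTranspose_one,
      hS.isHermitian.eq, ← starRingEnd_apply, Complex.conj_ofReal]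
    simp only [Matrix.sub_mul, Matrix.mul_sub, Matrix.smul_mul, Matrix.mul_smul, Matrix.mul_one,
      Matrix.one_mul, Matrix.nonsing_inv_mul _ hu, Matrix.mul_nonsing_inv _ hu]
    module
  rwa [e]

theorem posSemidef_portSum [Nonempty a] : (portSum a N).PosSemidef :=
  Matrix.posSemidef_sum _ fun i _ => posSemidef_portProj i

/-- The operators `X * portProj a i`, where `X` is proportional to the inverse of the upper bound
of `portSum`, form a measurement that is incomplete, but almost complete. -/
theorem exists_port_measurement_aux [Nonempty a] (hN : 0 < N) {κ : ℝ}
    (hκ : (Fintype.card a : ℝ) < κ) :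
    ∃ X : Matrix ((Fin N → a) × a) ((Fin N → a) × a) ℂ, X.PosSemidef ∧
      (∀ i, Commute X (portProj a i)) ∧ (1 - X * portSum a N).PosSemidef ∧
      (1 - Fintype.card a / κ) / (1 + κ * Fintype.card a / N + Fintype.card a ^ 3 / (2 * κ)) *
        (Fintype.card a : ℝ) ^ (N + 1) ≤ (X * portSum a N).trace.re := by
  have hbound := posSemidef_casimir_sub_portSum (a := a) (N := N)
    (lt_of_le_of_lt (Nat.cast_nonneg _) hκ)
  set d : ℝ := (Fintype.card a : ℝ) with hd
  have hd₀ : 0 < d := by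
    rw [hd]
    exact_mod_cast Fintype.card_pos
  have hdc : (d : ℂ) = Fintype.card a := by rw [hd]; norm_cast
  have hκ₀ : 0 < κ := hd₀.trans hκ
  have hN₀ : (0 : ℝ) < N := by exact_mod_cast hN
  set T := portSum a N with hT
  set Q := swapSum a N - (2 : ℂ) • T with hQ
  set β := d / (2 * κ) with hβ
  set α := N / d + κ / 2 + β * (N * d - N - N ^ 2 / d) with hα
  set γ := 1 - d / κ with hγ
  have hγ₀ : 0 < γ := by
    rw [hγ, sub_pos, div_lt_one hκ₀]
    exact hκ
  have hβ₀ : 0 < β := by positivity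
  set S := ((α + κ / 2 : ℝ) : ℂ) • (1 : Matrix ((Fin N → a) × a) ((Fin N → a) × a) ℂ) +
    (β : ℂ) • Q with hS
  have hTpsd : T.PosSemidef := posSemidef_portSum
  have hST : S - (γ : ℂ) • T - ((κ / 2 : ℝ) : ℂ) • 1 =
      (α : ℂ) • 1 + (β : ℂ) • Q - (γ : ℂ) • T := by
    rw [hS]
    push_cast
    module
  have hγT : ((γ : ℂ) • T).PosSemidef := hTpsd.smul (by rw [Complex.zero_le_real]; exact hγ₀.le)
  have hκ1 : (((κ / 2 : ℝ) : ℂ) • (1 : Matrix ((Fin N → a) × a) ((Fin N → a) × a) ℂ)).PosDef :=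
    Matrix.PosDef.one.smul (by rw [← Complex.ofReal_zero, Complex.real_lt_real]; positivity)
  have hSpd : S.PosDef := by
    have h := hκ1.add_posSemidef ((hST ▸ hbound).add hγT)
    convert h using 1
    abel
  have hSγT : (S - (γ : ℂ) • T).PosSemidef := by
    have h := (hST ▸ hbound).add hκ1.posSemidef
    convert h using 1
    abel
  have hu := (Matrix.isUnit_iff_isUnit_det _).1 hSpd.isUnit
  have hcomm : ∀ i, Commute S (portProj a i) := fun i =>
    ((Commute.one_left _).smul_left _).add_left ((commute_swapSum_sub_portProj i).smul_left _)
  have hcomm_inv : ∀ i, Commute S⁻¹ (portProj a i) := by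
    intro i
    have h := hcomm i
    calc S⁻¹ * portProj a i = S⁻¹ * (portProj a i * S) * S⁻¹ := by
          rw [Matrix.mul_assoc, Matrix.mul_assoc, Matrix.mul_nonsing_inv _ hu, Matrix.mul_one]
      _ = portProj a i * S⁻¹ := by
          rw [← h.eq, ← Matrix.mul_assoc, Matrix.nonsing_inv_mul _ hu, Matrix.one_mul]
  have hcommT : Commute S⁻¹ T := Commute.sum_right _ _ _ fun i _ => hcomm_inv i
  have hcommS : Commute S⁻¹ S := by
    rw [Commute, SemiconjBy, Matrix.nonsing_inv_mul _ hu, Matrix.mul_nonsing_inv _ hu]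
  refine ⟨(γ : ℂ) • S⁻¹, hSpd.inv.posSemidef.smul (by rw [Complex.zero_le_real]; exact hγ₀.le),
    fun i => (hcomm_inv i).smul_left _, ?_, ?_⟩
  · have h := hSpd.inv.posSemidef.mul_of_commute hSγT (hcommS.sub_right (hcommT.smul_right _))
    rwa [Matrix.mul_sub, Matrix.nonsing_inv_mul _ hu, Matrix.mul_smul, ← Matrix.smul_mul] at h
  · -- the traces of `T` and `S * T`
    set D : ℝ := d ^ N with hD
    have hD₀ : 0 < D := by positivity
    have htrT : T.trace = ((N * D : ℝ) : ℂ) := by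
      rw [hT, trace_portSum, ← hdc, hD]
      push_cast
      rfl
    have htrP : (swapSum a N * T).trace = ((N * D * (N + (N - 1) * N / d) : ℝ) : ℂ) := by
      have hdc0 : (d : ℂ) ≠ 0 := by exact_mod_cast hd₀.ne'
      rw [hT, trace_swapSum_mul_portSum, trace_swapSum, ← hdc, hD]
      push_cast
      field_simp
      ring
    have hTT : 0 ≤ (T * T).trace.re :=
      (Complex.le_def.1 (hTpsd.trace_mul_nonneg hTpsd)).1
    set s := N / d + κ + β * N * d with hs
    have hs₀ : 0 < s := by positivity
    have htrST : (S * T).trace.re ≤ N * D * s := by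
      have e : (S * T).trace.re =
          (α + κ / 2) * (N * D) + β * (N * D * (N + (N - 1) * N / d) - 2 * (T * T).trace.re) := by
        rw [hS, hQ, Matrix.add_mul, Matrix.smul_mul, Matrix.smul_mul, Matrix.sub_mul,
          Matrix.smul_mul, Matrix.one_mul, Matrix.trace_add, Matrix.trace_smul, Matrix.trace_smul,
          Matrix.trace_sub, Matrix.trace_smul, htrT, htrP]
        simp
      rw [e, hα, hs]
      have h1 : (N * D) * (N / d + κ + β * N * d) -
          ((N / d + κ / 2 + β * (N * d - N - N ^ 2 / d) + κ / 2) * (N * D) +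
            β * (N * D * (N + (N - 1) * N / d) - 2 * (T * T).trace.re)) =
          β * (N * D * (N / d)) + 2 * β * (T * T).trace.re := by ring
      have h2 : 0 ≤ β * (N * D * (N / d)) + 2 * β * (T * T).trace.re := by positivity
      linarith
    have htr := (hSpd.posSemidef_inv_sub (1 / s)).trace_mul_nonneg hTpsd
    have htr' : 2 * (1 / s) * (N * D) - (1 / s) ^ 2 * (S * T).trace.re ≤ (S⁻¹ * T).trace.re := by
      rw [Matrix.sub_mul, Matrix.sub_mul, Matrix.smul_mul, Matrix.smul_mul, Matrix.one_mul,
        Matrix.trace_sub, Matrix.trace_sub, Matrix.trace_smul, Matrix.trace_smul, htrT] at htr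
      have h := (Complex.le_def.1 htr).1
      rw [Complex.sub_re, Complex.sub_re, smul_eq_mul, smul_eq_mul, ← Complex.ofReal_pow,
        Complex.re_ofReal_mul] at h
      rw [show (2 * ((1 / s : ℝ) : ℂ)) * ((N * D : ℝ) : ℂ) = ((2 * (1 / s) * (N * D) : ℝ) : ℂ) by
        push_cast; ring, Complex.ofReal_re, Complex.zero_re] at h
      linarith
    have hge : N * D / s ≤ (S⁻¹ * T).trace.re := by
      refine le_trans ?_ htr'
      have h1 : (1 / s) ^ 2 * (S * T).trace.re ≤ (1 / s) ^ 2 * (N * D * s) := by gcongr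
      have h2 : (1 / s) ^ 2 * (N * D * s) = N * D / s := by field_simp
      have h3 : 2 * (1 / s) * (N * D) = 2 * (N * D / s) := by ring
      linarith
    rw [Matrix.smul_mul, Matrix.trace_smul, smul_eq_mul, Complex.re_ofReal_mul]
    refine le_trans (le_of_eq ?_) (mul_le_mul_of_nonneg_left hge hγ₀.le)
    have hs' : s = N / d * (1 + κ * d / N + d ^ 3 / (2 * κ)) := by
      rw [hs, hβ]
      field_simp
    rw [hs', pow_succ d N, ← hD]
    field_simp

/-- The effects `X * portProj a i` on the uniform mixture, which is what a maximally mixed input and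
the input halves of the ports form, occur with total probability at least `1 - ε`. -/
theorem exists_port_measurement (a : Type*) [DecidableEq a] [Fintype a] [Nonempty a] {ε : ℝ}
    (hε₀ : 0 < ε) (hε₁ : ε ≤ 1) :
    ∃ (N : ℕ) (X : Matrix ((Fin N → a) × a) ((Fin N → a) × a) ℂ), X.PosSemidef ∧
      (∀ i, Commute X (portProj a i)) ∧ (1 - X * portSum a N).PosSemidef ∧
      (1 - ε) * (Fintype.card a : ℝ) ^ (N + 1) ≤ (X * portSum a N).trace.re ∧
      0 < (X * portSum a N).trace.re := by
  have hd₀ : (0 : ℝ) < Fintype.card a := by exact_mod_cast Fintype.card_pos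
  set d : ℝ := (Fintype.card a : ℝ) with hd
  obtain ⟨K, hK⟩ := exists_nat_gt ((2 * d + d ^ 3) / ε)
  have hK₀ : (0 : ℝ) < K := lt_trans (by positivity) hK
  rw [div_lt_iff₀ hε₀] at hK
  have hd3 : 0 < d ^ 3 := by positivity
  have hdK : d < K := by nlinarith
  -- for `κ = K` and `N = K ^ 2` all the terms that are lost are of order `1 / K`
  obtain ⟨X, hX, hXc, hXT, htr⟩ := exists_port_measurement_aux (a := a) (N := K ^ 2) (κ := K)
    (pow_pos (by exact_mod_cast hK₀) 2) hdK
  rw [← hd] at htr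
  have hγ : 0 < 1 - d / K := by
    rw [sub_pos, div_lt_one hK₀]
    exact hdK
  have hden : 1 + (K : ℝ) * d / ((K ^ 2 : ℕ) : ℝ) + d ^ 3 / (2 * K) =
      1 + d / K + d ^ 3 / (2 * K) := by
    push_cast
    field_simp
  rw [hden] at htr
  refine ⟨K ^ 2, X, hX, hXc, hXT, le_trans ?_ htr, lt_of_lt_of_le (by positivity) htr⟩
  gcongr
  rw [le_div_iff₀ (by positivity)]
  have h1 : d / K + d ^ 3 / (2 * K) + d / K ≤ ε := by
    rw [show d / K + d ^ 3 / (2 * K) + d / K = (2 * d + d ^ 3 / 2) / K by field_simp; ring,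
      div_le_iff₀ hK₀]
    linarith
  have h2 : 0 ≤ d / K + d ^ 3 / (2 * K) := by positivity
  nlinarith

end PortMeasurement

/-! ### The programmed gate -/

section Gate

variable {a b c : Type*} {N : ℕ}

/-- All coordinates except the `i`-th. -/
def restrictNe (i : Fin N) (r : Fin N → c) : {l // l ≠ i} → c := fun l => r l

/-- The tuple with `i`-th coordinate `k` and the other coordinates `ζ`. -/
def glueAt (i : Fin N) (k : c) (ζ : {l // l ≠ i} → c) : Fin N → c :=
  fun l => if h : l = i then k else ζ ⟨l, h⟩

theorem glueAt_self (i : Fin N) (k : c) (ζ : {l // l ≠ i} → c) : glueAt i k ζ i = k := by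
  simp [glueAt]

theorem glueAt_coe (i : Fin N) (k : c) (ζ : {l // l ≠ i} → c) (l : {l // l ≠ i}) :
    glueAt i k ζ l = ζ l := by
  simp [glueAt, l.2]

theorem restrictNe_glueAt (i : Fin N) (k : c) (ζ : {l // l ≠ i} → c) :
    restrictNe i (glueAt i k ζ) = ζ :=
  funext fun l => glueAt_coe i k ζ l

theorem glueAt_restrictNe (i : Fin N) (k : c) (r : Fin N → c) :
    glueAt i k (restrictNe i r) = Function.update r i k := by
  ext l
  by_cases h : l = i
  · subst h
    simp [glueAt]
  · simp [glueAt, restrictNe, h]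

theorem eq_iff_restrictNe (i : Fin N) {r r' : Fin N → c} :
    r = r' ↔ r i = r' i ∧ restrictNe i r = restrictNe i r' := by
  refine ⟨fun h => h ▸ ⟨rfl, rfl⟩, fun ⟨h1, h2⟩ => ?_⟩
  ext l
  by_cases h : l = i
  · rw [h, h1]
  · exact congrFun h2 ⟨l, h⟩

theorem portProj_apply_comm [DecidableEq a] (i : Fin N) (u v : (Fin N → a) × a) :
    portProj a i u v = portProj a i v u := by
  rw [← (isHermitian_portProj i).apply]
  simp [portProj, apply_ite]

/-- An operator that is supported on `Ω` has the form `|Ω⟩⟨Ω| ⊗ Θ`. -/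
theorem exists_of_portProj_mul [Fintype a] [DecidableEq a] [Nonempty a] {i : Fin N}
    {M : Matrix ((Fin N → a) × a) ((Fin N → a) × a) ℂ}
    (h1 : portProj a i * M = (Fintype.card a : ℂ) • M)
    (h2 : M * portProj a i = (Fintype.card a : ℂ) • M) :
    ∃ Θ : Matrix ({l // l ≠ i} → a) ({l // l ≠ i} → a) ℂ, ∀ u v,
      M u v = if u.1 i = u.2 ∧ v.1 i = v.2 then Θ (restrictNe i u.1) (restrictNe i v.1) else 0 := by
  have hd : (Fintype.card a : ℂ) ≠ 0 := by exact_mod_cast Fintype.card_ne_zero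
  have e1 : ∀ u v, M u v = (Fintype.card a : ℂ)⁻¹ *
      if u.1 i = u.2 then ∑ y, M (glueAt i y (restrictNe i u.1), y) v else 0 := by
    intro u v
    have h := congrFun (congrFun h1 u) v
    rw [Matrix.smul_apply, smul_eq_mul] at h
    rw [eq_inv_mul_iff_mul_eq₀ hd, ← h]
    simp only [glueAt_restrictNe]
    exact portProj_mulVec i (fun w => M w v) u
  have e2 : ∀ u v, M u v = (Fintype.card a : ℂ)⁻¹ *
      if v.1 i = v.2 then ∑ y, M u (glueAt i y (restrictNe i v.1), y) else 0 := by
    intro u v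
    have h := congrFun (congrFun h2 u) v
    rw [Matrix.smul_apply, smul_eq_mul] at h
    rw [eq_inv_mul_iff_mul_eq₀ hd, ← h]
    simp only [glueAt_restrictNe]
    refine Eq.trans ?_ (portProj_mulVec i (fun w => M u w) v)
    exact Finset.sum_congr rfl fun w _ =>
      (mul_comm _ _).trans (congrArg (· * M u w) (portProj_apply_comm i w v))
  refine ⟨Matrix.of fun ξ ζ => (Fintype.card a : ℂ)⁻¹ * ∑ y, ((Fintype.card a : ℂ)⁻¹ *
    ∑ z, M (glueAt i y ξ, y) (glueAt i z ζ, z)), fun u v => ?_⟩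
  rw [e1]
  by_cases hu : u.1 i = u.2
  · simp only [hu, if_true, true_and, Matrix.of_apply]
    by_cases hv : v.1 i = v.2
    · simp only [hv, if_true]
      congr 1
      refine Finset.sum_congr rfl fun y _ => ?_
      rw [e2]
      simp only [hv, if_true]
    · simp only [hv, if_false]
      rw [Finset.sum_eq_zero, mul_zero]
      intro y _
      rw [e2]
      simp [hv]
  · simp [hu]

/-- The program of a channel: a normalized Choi state in each port. -/
noncomputable def portProgram [Fintype a] [DecidableEq a] (N : ℕ) (U : SuperOp a b) :
    Matrix ((Fin N → a) × (Fin N → b)) ((Fin N → a) × (Fin N → b)) ℂ :=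
  Matrix.of fun u v =>
    ∏ l, ((Fintype.card a : ℂ)⁻¹ * U.choi (u.2 l, u.1 l) (v.2 l, v.1 l))

/-- The Schur product theorem for finitely many factors. -/
theorem Matrix.posSemidef_prod {ι n : Type*} (s : Finset ι) (A : ι → Matrix n n ℂ)
    (hA : ∀ l ∈ s, (A l).PosSemidef) : (Matrix.of fun u v => ∏ l ∈ s, A l u v).PosSemidef := by
  classical
  induction s using Finset.induction_on with
  | empty =>
    have h := Matrix.posSemidef_vecMulVec_self_star (fun _ : Unit => (1 : ℂ))
    convert h.submatrix fun _ : n => () using 1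
    ext u v
    simp [Matrix.vecMulVec_apply]
  | insert l s hl ih =>
    have h := (hA l (Finset.mem_insert_self l s)).hadamard
      (ih fun m hm => hA m (Finset.mem_insert_of_mem hm))
    have e : (Matrix.of fun u v => ∏ m ∈ insert l s, A m u v) =
        A l ⊙ Matrix.of fun u v => ∏ m ∈ s, A m u v := by
      ext u v
      rw [Matrix.of_apply, Finset.prod_insert hl]
      rfl
    rw [e]
    exact h

/-- The partial trace of a product of Choi matrices over the outputs. -/
theorem sum_prod_choi [Fintype a] [DecidableEq a] [Fintype b] {ι : Type*} [Fintype ι]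
    [DecidableEq ι] {U : SuperOp a b} (hU : IsChannel U) (r r' : ι → a) :
    ∑ β : ι → b, ∏ l, ((Fintype.card a : ℂ)⁻¹ * U.choi (β l, r l) (β l, r' l)) =
      if r = r' then ((Fintype.card a : ℂ)⁻¹) ^ Fintype.card ι else 0 := by
  have h := Finset.prod_univ_sum (fun _ : ι => (Finset.univ : Finset b))
    (fun l p => (Fintype.card a : ℂ)⁻¹ * U.choi (p, r l) (p, r' l))
  rw [Fintype.piFinset_univ] at h
  rw [← h]
  simp only [← Finset.mul_sum, hU.sum_choi_apply]
  split_ifs with hr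
  · simp [hr]
  · obtain ⟨l, hl⟩ := Function.ne_iff.1 hr
    exact Finset.prod_eq_zero (Finset.mem_univ l) (by simp [hl])

theorem isState_portProgram [Fintype a] [DecidableEq a] [Nonempty a] [Fintype b] {U : SuperOp a b}
    (hU : IsChannel U) : IsState (portProgram N U) := by
  have hd : (Fintype.card a : ℂ) ≠ 0 := by exact_mod_cast Fintype.card_ne_zero
  constructor
  · have hc : (0 : ℂ) ≤ (Fintype.card a : ℂ)⁻¹ := by
      rw [← Complex.ofReal_natCast, ← Complex.ofReal_inv, Complex.zero_le_real]
      positivity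
    exact Matrix.posSemidef_prod Finset.univ (fun l => (Fintype.card a : ℂ)⁻¹ •
      U.choi.submatrix (fun u : (Fin N → a) × (Fin N → b) => (u.2 l, u.1 l))
        fun u : (Fin N → a) × (Fin N → b) => (u.2 l, u.1 l)) fun l _ =>
          (hU.1.choi_posSemidef.submatrix _).smul hc
  · simp only [Matrix.trace, Matrix.diag_apply, portProgram, Matrix.of_apply,
      Fintype.sum_prod_type, sum_prod_choi hU, if_true]
    simp [hd]

/-- The Choi matrix of the branch that announces success: `κ • M i` is the effect for the
`i`-th port, and this port is the output, while the other ones are discarded. The effect enters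
with its indices exchanged, since `ofChoi` pairs the Choi matrix with the input entrywise. -/
noncomputable def successChoi [DecidableEq b] (κ : ℝ)
    (M : Fin N → Matrix ((Fin N → a) × a) ((Fin N → a) × a) ℂ) :
    Matrix (b × (((Fin N → a) × (Fin N → b)) × a)) (b × (((Fin N → a) × (Fin N → b)) × a)) ℂ :=
  (κ : ℂ) • ∑ i, Matrix.of fun x y => M i (y.2.1.1, y.2.2) (x.2.1.1, x.2.2) *
    (((if x.2.1.2 i = x.1 then 1 else 0) * (if y.2.1.2 i = y.1 then 1 else 0)) *
      (1 : Matrix ({l // l ≠ i} → b) _ ℂ) (restrictNe i x.2.1.2) (restrictNe i y.2.1.2))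

/-- The Choi matrix of the branch that announces failure: the effect is `E`, everything is
discarded, and `ρ₀` is the output. As in `successChoi`, the indices of `E` are exchanged. -/
def failureChoi [DecidableEq b] (ρ₀ : Matrix b b ℂ)
    (E : Matrix ((Fin N → a) × a) ((Fin N → a) × a) ℂ) :
    Matrix (b × (((Fin N → a) × (Fin N → b)) × a)) (b × (((Fin N → a) × (Fin N → b)) × a)) ℂ :=
  Matrix.of fun x y => ρ₀ x.1 y.1 * (E (y.2.1.1, y.2.2) (x.2.1.1, x.2.2) *
    (1 : Matrix (Fin N → b) _ ℂ) x.2.1.2 y.2.1.2)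

theorem posSemidef_successChoi [Finite a] [Finite b] [DecidableEq b] {κ : ℝ} (hκ : 0 ≤ κ)
    {M : Fin N → Matrix ((Fin N → a) × a) ((Fin N → a) × a) ℂ} (hM : ∀ i, (M i).PosSemidef) :
    (successChoi (b := b) κ M).PosSemidef := by
  refine (Matrix.posSemidef_sum _ fun i _ => ?_).smul (by rwa [Complex.zero_le_real])
  have h1 := (hM i).transpose.submatrix fun x : b × (((Fin N → a) × (Fin N → b)) × a) =>
    (x.2.1.1, x.2.2)
  have h2 := Matrix.posSemidef_vecMulVec_self_star
    (fun x : b × (((Fin N → a) × (Fin N → b)) × a) => if x.2.1.2 i = x.1 then (1 : ℂ) else 0)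
  have h3 := (Matrix.PosSemidef.one (n := {l // l ≠ i} → b) (R := ℂ)).submatrix
    fun x : b × (((Fin N → a) × (Fin N → b)) × a) => restrictNe i x.2.1.2
  have e : Matrix.vecMulVec
      (fun x : b × (((Fin N → a) × (Fin N → b)) × a) => if x.2.1.2 i = x.1 then (1 : ℂ) else 0)
      (star fun x : b × (((Fin N → a) × (Fin N → b)) × a) =>
        if x.2.1.2 i = x.1 then (1 : ℂ) else 0) =
      Matrix.of fun x y => (if x.2.1.2 i = x.1 then 1 else 0) *
        (if y.2.1.2 i = y.1 then 1 else 0) := by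
    ext x y
    rw [Matrix.vecMulVec_apply, Pi.star_apply, Matrix.of_apply]
    by_cases hy : y.2.1.2 i = y.1 <;> simp [hy]
  rw [e] at h2
  exact h1.hadamard (h2.hadamard h3)

theorem posSemidef_failureChoi [DecidableEq b] {ρ₀ : Matrix b b ℂ} (hρ₀ : ρ₀.PosSemidef)
    {E : Matrix ((Fin N → a) × a) ((Fin N → a) × a) ℂ} (hE : E.PosSemidef) :
    (failureChoi ρ₀ E).PosSemidef :=
  (hρ₀.submatrix Prod.fst).hadamard ((hE.transpose.submatrix
    fun x : b × (((Fin N → a) × (Fin N → b)) × a) => (x.2.1.1, x.2.2)).hadamard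
      (Matrix.PosSemidef.one.submatrix fun x : b × (((Fin N → a) × (Fin N → b)) × a) => x.2.1.2))

theorem sum_successChoi [Fintype b] [DecidableEq b] (κ : ℝ)
    (M : Fin N → Matrix ((Fin N → a) × a) ((Fin N → a) × a) ℂ)
    (x y : ((Fin N → a) × (Fin N → b)) × a) :
    ∑ p, successChoi κ M (p, x) (p, y) =
      (κ : ℂ) * (∑ i, M i) (y.1.1, y.2) (x.1.1, x.2) *
        (1 : Matrix (Fin N → b) _ ℂ) x.1.2 y.1.2 := by
  simp only [successChoi, Matrix.smul_apply, Matrix.sum_apply, Matrix.of_apply, smul_eq_mul]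
  rw [← Finset.mul_sum, Finset.sum_comm, mul_assoc, Finset.sum_mul]
  congr 1
  refine Finset.sum_congr rfl fun i _ => ?_
  change ∑ p, M i (y.1.1, y.2) (x.1.1, x.2) * (((if x.1.2 i = p then 1 else 0) *
    (if y.1.2 i = p then 1 else 0)) * (1 : Matrix ({l // l ≠ i} → b) _ ℂ) (restrictNe i x.1.2)
      (restrictNe i y.1.2)) = _
  rw [← Finset.mul_sum, ← Finset.sum_mul]
  congr 1
  simp only [Matrix.one_apply, eq_iff_restrictNe i (r := x.1.2), ite_and]
  by_cases h : x.1.2 i = y.1.2 i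
  · simp [h]
  · simp [h]

theorem sum_failureChoi [Fintype b] [DecidableEq b] {ρ₀ : Matrix b b ℂ} (hρ₀ : IsState ρ₀)
    (E : Matrix ((Fin N → a) × a) ((Fin N → a) × a) ℂ)
    (x y : ((Fin N → a) × (Fin N → b)) × a) :
    ∑ p, failureChoi ρ₀ E (p, x) (p, y) =
      E (y.1.1, y.2) (x.1.1, x.2) * (1 : Matrix (Fin N → b) _ ℂ) x.1.2 y.1.2 := by
  simp only [failureChoi, Matrix.of_apply]
  change ∑ p, ρ₀ p p * (E (y.1.1, y.2) (x.1.1, x.2) * (1 : Matrix (Fin N → b) _ ℂ) x.1.2 y.1.2) = _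
  rw [← Finset.sum_mul, show ∑ p, ρ₀ p p = 1 from hρ₀.2, one_mul]

/-- If the effect is supported on `Ω`, port `i` contains the output of the programmed channel. -/
theorem sum_portProgram_branch [Fintype a] [DecidableEq a] [Nonempty a] [Fintype b] [DecidableEq b]
    {U : SuperOp a b} (hU : IsChannel U) {i : Fin N}
    {M : Matrix ((Fin N → a) × a) ((Fin N → a) × a) ℂ}
    (h1 : portProj a i * M = (Fintype.card a : ℂ) • M)
    (h2 : M * portProj a i = (Fintype.card a : ℂ) • M) (ρ : Matrix a a ℂ) (p q : b) :
    ∑ x : ((Fin N → a) × (Fin N → b)) × a, ∑ y : ((Fin N → a) × (Fin N → b)) × a,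
      M (y.1.1, y.2) (x.1.1, x.2) *
        (((if x.1.2 i = p then 1 else 0) * (if y.1.2 i = q then 1 else 0)) *
          (1 : Matrix ({l // l ≠ i} → b) _ ℂ) (restrictNe i x.1.2) (restrictNe i y.1.2)) *
        (portProgram N U x.1 y.1 * ρ x.2 y.2) =
      ((Fintype.card a : ℂ)⁻¹) ^ (N + 1) * M.trace * U ρ p q := by
  obtain ⟨Θ, hΘ⟩ := exists_of_portProj_mul h1 h2
  have hd : (Fintype.card a : ℂ) ≠ 0 := by exact_mod_cast Fintype.card_ne_zero
  -- the indices for which the summand does not vanish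
  let F : b → a × ({l // l ≠ i} → a) × ({l // l ≠ i} → b) → ((Fin N → a) × (Fin N → b)) × a :=
    fun p w => ((glueAt i w.1 w.2.1, glueAt i p w.2.2), w.1)
  have hF : ∀ p, Function.Injective (F p) := by
    rintro p ⟨k, ζ, γ⟩ ⟨k', ζ', γ'⟩ h
    simp only [F, Prod.mk.injEq] at h
    obtain ⟨⟨h1, h2⟩, h3⟩ := h
    refine Prod.ext h3 (Prod.ext ?_ ?_)
    · simpa only [restrictNe_glueAt] using congrArg (restrictNe i) h1
    · simpa only [restrictNe_glueAt] using congrArg (restrictNe i) h2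
  have hrange : ∀ p x, x.1.1 i = x.2 → x.1.2 i = p → x ∈ Set.range (F p) := by
    rintro p ⟨⟨r, β⟩, k⟩ hk hp
    refine ⟨(k, restrictNe i r, restrictNe i β), ?_⟩
    simp only [F, glueAt_restrictNe, Prod.mk.injEq, and_true]
    change r i = k at hk
    change β i = p at hp
    rw [← hk, ← hp, Function.update_eq_self, Function.update_eq_self]
    exact ⟨rfl, rfl⟩
  have hsum : ∀ (p : b) (g : ((Fin N → a) × (Fin N → b)) × a → ℂ),
      (∀ x, ¬ (x.1.1 i = x.2 ∧ x.1.2 i = p) → g x = 0) → ∑ x, g x = ∑ w, g (F p w) := by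
    intro p g hg
    refine (Fintype.sum_of_injective (F p) (hF p) _ g (fun x hx => hg x ?_) fun _ => rfl).symm
    exact fun h => hx (hrange p x h.1 h.2)
  rw [hsum p _ (fun x hx => ?_)]
  swap
  · refine Finset.sum_eq_zero fun y _ => ?_
    rw [not_and_or] at hx
    rcases hx with hx | hx
    · simp [hΘ, hx]
    · simp [hx]
  rw [Finset.sum_congr rfl fun w _ => hsum q _ fun y hy => ?_]
  swap
  · rw [not_and_or] at hy
    rcases hy with hy | hy
    · simp [hΘ, hy]
    · simp [hy]
  have hprog : ∀ (k k' : a) (ζ ζ' : {l // l ≠ i} → a) (γ γ' : {l // l ≠ i} → b),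
      portProgram N U (glueAt i k ζ, glueAt i p γ) (glueAt i k' ζ', glueAt i q γ') =
        (Fintype.card a : ℂ)⁻¹ * U.choi (p, k) (q, k') *
          ∏ l, ((Fintype.card a : ℂ)⁻¹ * U.choi (γ l, ζ l) (γ' l, ζ' l)) := by
    intro k k' ζ ζ' γ γ'
    rw [portProgram, Matrix.of_apply, Fintype.prod_eq_mul_prod_subtype_ne _ i]
    simp only [glueAt_self, glueAt_coe]
  have hcard : Fintype.card {l // l ≠ i} + 1 = N := by
    have := Fintype.card_pos_iff.2 ⟨i⟩
    rw [Fintype.card_subtype_compl, Fintype.card_subtype_eq, Fintype.card_fin] at *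
    omega
  have htr : M.trace = Fintype.card a * ∑ ζ, Θ ζ ζ := by
    have h := Fintype.sum_of_injective
      (fun w : a × ({l // l ≠ i} → a) => (glueAt i w.1 w.2, w.1)) (fun w w' h => ?_)
      (fun w => Θ w.2 w.2) (fun u => M u u) (fun u hu => ?_) fun w => ?_
    · rw [Matrix.trace, ← nsmul_eq_mul]
      refine h.symm.trans ?_
      simp [Fintype.sum_prod_type]
    · obtain ⟨h3, h4⟩ := Prod.mk.inj h
      exact Prod.ext h4 (by simpa only [restrictNe_glueAt] using congrArg (restrictNe i) h3)
    · rw [hΘ, if_neg]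
      rintro ⟨h3, -⟩
      refine hu ⟨(u.2, restrictNe i u.1), Prod.ext ?_ rfl⟩
      change glueAt i u.2 (restrictNe i u.1) = u.1
      rw [glueAt_restrictNe, ← h3, Function.update_eq_self]
    · simp [hΘ, glueAt_self, restrictNe_glueAt]
  simp only [F, hΘ, glueAt_self, restrictNe_glueAt, hprog, and_self, if_true,
    Fintype.sum_prod_type, Matrix.one_apply, mul_ite, ite_mul, mul_one, mul_zero, zero_mul,
    Finset.sum_ite_eq, Finset.mem_univ]
  calc _ = ∑ k, ∑ k', ((Fintype.card a : ℂ)⁻¹ * (U.choi (p, k) (q, k') * ρ k k')) *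
        ∑ ζ, ∑ ξ, Θ ξ ζ * ∑ γ : {l // l ≠ i} → b,
          ∏ l, ((Fintype.card a : ℂ)⁻¹ * U.choi (γ l, ζ l) (γ l, ξ l)) := by
        refine Finset.sum_congr rfl fun k _ => ?_
        refine ((Finset.sum_congr rfl fun ζ _ => Finset.sum_comm).trans Finset.sum_comm).trans ?_
        refine Finset.sum_congr rfl fun k' _ => ?_
        rw [Finset.mul_sum]
        refine Finset.sum_congr rfl fun ζ _ => ?_
        rw [Finset.sum_comm, Finset.mul_sum]
        refine Finset.sum_congr rfl fun ξ _ => ?_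
        rw [Finset.mul_sum, Finset.mul_sum]
        exact Finset.sum_congr rfl fun γ _ => by ring
    _ = ((Fintype.card a : ℂ)⁻¹) ^ (N + 1) * M.trace * U ρ p q := by
        have hU' : U ρ p q = ∑ k, ∑ k', U.choi (p, k) (q, k') * ρ k k' := by
          conv_lhs => rw [← SuperOp.ofChoi_choi U]
          rfl
        have hΘ' : ∑ ζ, ∑ ξ, Θ ξ ζ * ∑ γ : {l // l ≠ i} → b,
            ∏ l, ((Fintype.card a : ℂ)⁻¹ * U.choi (γ l, ζ l) (γ l, ξ l)) =
            ((Fintype.card a : ℂ)⁻¹) ^ N * M.trace := by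
          simp only [sum_prod_choi hU, mul_ite, mul_zero, Finset.sum_ite_eq, Finset.mem_univ,
            if_true, ← Finset.sum_mul]
          have hpow : ((Fintype.card a : ℂ)⁻¹) ^ N =
              ((Fintype.card a : ℂ)⁻¹) ^ Fintype.card {l // l ≠ i} * (Fintype.card a : ℂ)⁻¹ := by
            rw [← pow_succ, hcard]
          rw [htr, hpow, mul_assoc, inv_mul_cancel_left₀ hd, mul_comm]
        simp only [hΘ', ← Finset.sum_mul, ← Finset.mul_sum, ← hU']
        ring

end Gate

/-! ### Programmability -/

section Program

variable {a b T π : Type*} [Fintype a] [Fintype b] [Fintype π]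

/-- A programmed gate may be given by the Choi matrices of its two branches, with the program
system indexed by any finite type and with nothing left to be traced out. -/
theorem isProgrammableWithFailure_of_choi {U : T → SuperOp a b} {ε : ℝ} {ρ₀ : Matrix b b ℂ}
    [DecidableEq a] [DecidableEq π] {Js Jf : Matrix (b × (π × a)) (b × (π × a)) ℂ}
    (hs : Js.PosSemidef) (hf : Jf.PosSemidef)
    (htr : ∀ x y, ∑ p, (Js + Jf) (p, x) (p, y) = if x = y then 1 else 0)
    {τ : T → Matrix π π ℂ} (hτ : ∀ t, IsState (τ t))
    (hS : ∀ t ρ, IsState ρ → SuperOp.ofChoi Js (τ t ⊗ₖ ρ) = ((1 - ε : ℝ) : ℂ) • U t ρ)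
    (hF : ∀ t ρ, IsState ρ → SuperOp.ofChoi Jf (τ t ⊗ₖ ρ) = (ε : ℂ) • ρ₀) :
    IsProgrammableWithFailure U ε ρ₀ := by
  let e := Fintype.equivFin π
  let f : (Fin 1 × b) × (Fin (Fintype.card π) × a) → b × (π × a) :=
    fun z => (z.1.2, (e.symm z.2.1, z.2.2))
  have hptrace : ∀ (J : Matrix (b × (π × a)) (b × (π × a)) ℂ) t ρ,
      ptraceFst (SuperOp.ofChoi (J.submatrix f f) ((τ t).submatrix e.symm e.symm ⊗ₖ ρ)) =
        SuperOp.ofChoi J (τ t ⊗ₖ ρ) := by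
    intro J t ρ
    ext p q
    simp only [ptraceFst, Matrix.of_apply, Fin.sum_univ_one, SuperOp.ofChoi_apply]
    refine Fintype.sum_equiv (e.symm.prodCongr (Equiv.refl a)) _ _ fun i => ?_
    exact Fintype.sum_equiv (e.symm.prodCongr (Equiv.refl a)) _ _ fun j => rfl
  have hadd : SuperOp.ofChoi (Js.submatrix f f) + SuperOp.ofChoi (Jf.submatrix f f) =
      SuperOp.ofChoi ((Js + Jf).submatrix f f) := by
    refine LinearMap.ext fun X => ?_
    ext p q
    simp [SuperOp.ofChoi_apply, add_mul, Finset.sum_add_distrib]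
  refine ⟨Fintype.card π, 1, fun t => (τ t).submatrix e.symm e.symm,
    SuperOp.ofChoi (Js.submatrix f f), SuperOp.ofChoi (Jf.submatrix f f), fun t => ⟨?_, ?_⟩,
    SuperOp.isCompletelyPositive_ofChoi (hs.submatrix f),
    SuperOp.isCompletelyPositive_ofChoi (hf.submatrix f), ?_, fun t ρ hρ => ⟨?_, ?_⟩⟩
  · exact (hτ t).1.submatrix _
  · rw [← (hτ t).2]
    exact Fintype.sum_equiv e.symm _ _ fun _ => rfl
  · rw [hadd]
    refine IsChannel.of_choi ((hs.add hf).submatrix f) fun i j => ?_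
    rw [Fintype.sum_prod_type, Fin.sum_univ_one]
    refine (htr (e.symm i.1, i.2) (e.symm j.1, j.2)).trans ?_
    simp [Prod.ext_iff]
  · rw [hptrace, hS t ρ hρ]
  · rw [hptrace, hF t ρ hρ]

/-- If a gate programs `U t` with failures, it programs the noisy channel, once the announcement
is ignored. -/
theorem IsProgrammableWithFailure.isProgrammable_noisy {U : T → SuperOp a b} {ε : ℝ}
    {ρ₀ : Matrix b b ℂ} (h : IsProgrammableWithFailure U ε ρ₀) :
    IsProgrammable fun t => noisy ε ρ₀ (U t) := by
  obtain ⟨p, q, τ, Gs, Gf, hτ, -, -, hG, h⟩ := h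
  refine ⟨p, q, τ, Gs + Gf, hτ, hG, fun t ρ hρ => ?_⟩
  have hadd : ∀ X Y : Matrix (Fin q × b) (Fin q × b) ℂ,
      ptraceFst (X + Y) = ptraceFst X + ptraceFst Y := by
    intro X Y
    ext i j
    simp [ptraceFst, Finset.sum_add_distrib]
  rw [noisy_apply_state ε ρ₀ (U t) hρ, LinearMap.add_apply, hadd, (h t ρ hρ).1, (h t ρ hρ).2,
    add_comm]

theorem isProgrammableWithFailure {ε : ℝ} (hε₀ : 0 < ε) (hε₁ : ε ≤ 1) {ρ₀ : Matrix b b ℂ}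
    (hρ₀ : IsState ρ₀) {U : T → SuperOp a b} (hU : ∀ t, IsChannel (U t)) :
    IsProgrammableWithFailure U ε ρ₀ := by
  classical
  rcases isEmpty_or_nonempty a with ha | ha
  · -- without inputs there are no states
    have hno : ∀ ρ : Matrix a a ℂ, ¬ IsState ρ := fun ρ hρ => by
      simpa [Matrix.trace] using hρ.2
    exact isProgrammableWithFailure_of_choi (π := Unit) (Js := 0) (Jf := 0) Matrix.PosSemidef.zero
      Matrix.PosSemidef.zero (fun x => isEmptyElim x.2) (τ := fun _ => 1)
      (fun _ => ⟨Matrix.PosSemidef.one, by simp⟩) (fun _ ρ hρ => (hno ρ hρ).elim)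
      fun _ ρ hρ => (hno ρ hρ).elim
  obtain ⟨N, X, hX, hcomm, hle, htrace, hpos⟩ := exists_port_measurement a hε₀ hε₁
  have hd : (0 : ℝ) < (Fintype.card a : ℝ) ^ (N + 1) := by
    have : 0 < Fintype.card a := Fintype.card_pos
    positivity
  set S := X * portSum a N with hSdef
  let M : Fin N → Matrix ((Fin N → a) × a) ((Fin N → a) × a) ℂ := fun i => X * portProj a i
  have hMsum : ∑ i, M i = S := by
    simp only [M, ← Finset.mul_sum]
    rfl
  have hM : ∀ i, (M i).PosSemidef := fun i =>
    hX.mul_of_commute (posSemidef_portProj i) (hcomm i)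
  have hSpos : S.PosSemidef := hMsum ▸ Matrix.posSemidef_sum _ fun i _ => hM i
  have h1 : ∀ i, portProj a i * M i = (Fintype.card a : ℂ) • M i := fun i => by
    change portProj a i * (X * portProj a i) = _
    rw [← mul_assoc, ← (hcomm i).eq, mul_assoc, portProj_mul_self, Matrix.mul_smul]
  have h2 : ∀ i, M i * portProj a i = (Fintype.card a : ℂ) • M i := fun i => by
    change X * portProj a i * portProj a i = _
    rw [mul_assoc, portProj_mul_self, Matrix.mul_smul]
  have htr : (S.trace.re : ℂ) = S.trace :=
    Complex.ext rfl (Complex.nonneg_iff.1 hSpos.trace_nonneg).2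
  -- the surplus of success probability is given away
  let κ : ℝ := (1 - ε) * (Fintype.card a : ℝ) ^ (N + 1) / S.trace.re
  have hκ₀ : 0 ≤ κ := div_nonneg (mul_nonneg (by linarith) hd.le) hpos.le
  have hκ₁ : κ ≤ 1 := (div_le_one hpos).2 htrace
  have hκ : (κ : ℂ) * (((Fintype.card a : ℂ)⁻¹) ^ (N + 1) * S.trace) = ((1 - ε : ℝ) : ℂ) := by
    have h : κ * (((Fintype.card a : ℝ)⁻¹) ^ (N + 1) * S.trace.re) = 1 - ε := by
      simp only [κ, inv_pow]
      field_simp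
    rw [← htr]
    have h' := congrArg Complex.ofReal h
    push_cast at h' ⊢
    exact h'
  have hE : (1 - (κ : ℂ) • S).PosSemidef := by
    have e : 1 - (κ : ℂ) • S = ((1 - κ : ℝ) : ℂ) • 1 + (κ : ℂ) • (1 - S) := by
      push_cast
      rw [sub_smul, smul_sub, one_smul]
      abel
    rw [e]
    exact (Matrix.PosSemidef.one.smul (by rw [Complex.zero_le_real]; linarith)).add
      (hle.smul (by rwa [Complex.zero_le_real]))
  have hsum : ∀ x y : ((Fin N → a) × (Fin N → b)) × a,
      ∑ p, (successChoi κ M + failureChoi ρ₀ (1 - (κ : ℂ) • S) :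
        Matrix (b × _) (b × _) ℂ) (p, x) (p, y) = if x = y then 1 else 0 := by
    intro x y
    simp only [Matrix.add_apply, Finset.sum_add_distrib]
    rw [sum_successChoi, sum_failureChoi hρ₀, hMsum, ← add_mul, Matrix.sub_apply,
      Matrix.smul_apply, smul_eq_mul, add_sub_cancel]
    simp only [Matrix.one_apply, Prod.ext_iff, eq_comm (a := y.1.1), eq_comm (a := y.2)]
    split_ifs <;> simp_all
  have hS : ∀ t ρ, SuperOp.ofChoi (successChoi κ M) (portProgram N (U t) ⊗ₖ ρ) =
      ((1 - ε : ℝ) : ℂ) • U t ρ := by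
    intro t ρ
    ext p q
    rw [Matrix.smul_apply, smul_eq_mul, ← hκ, ← hMsum, Matrix.trace_sum, Finset.mul_sum,
      mul_assoc, Finset.sum_mul, SuperOp.ofChoi_apply]
    simp only [← sum_portProgram_branch (hU t) (h1 _) (h2 _) ρ p q]
    simp only [successChoi, Matrix.smul_apply, Matrix.sum_apply, Matrix.of_apply, smul_eq_mul,
      Matrix.kroneckerMap_apply, Finset.mul_sum, Finset.sum_mul]
    refine (Finset.sum_congr rfl fun x _ => Finset.sum_comm).trans
      (Finset.sum_comm.trans (Finset.sum_congr rfl fun i _ => Finset.sum_congr rfl fun x _ =>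
        Finset.sum_congr rfl fun y _ => ?_))
    exact mul_assoc _ _ _
  refine isProgrammableWithFailure_of_choi (posSemidef_successChoi hκ₀ hM)
    (posSemidef_failureChoi hρ₀.1 hE) hsum (fun t => isState_portProgram (N := N) (hU t))
    (fun t ρ _ => hS t ρ) fun t ρ hρ => ?_
  have hτρ : IsState (portProgram N (U t) ⊗ₖ ρ) :=
    ⟨(isState_portProgram (hU t)).1.kronecker hρ.1, by
      rw [Matrix.trace_kronecker, (isState_portProgram (hU t)).2, hρ.2, one_mul]⟩
  obtain ⟨c, hc⟩ : ∃ c : ℂ, SuperOp.ofChoi (failureChoi ρ₀ (1 - (κ : ℂ) • S))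
      (portProgram N (U t) ⊗ₖ ρ) = c • ρ₀ := by
    refine ⟨∑ x, ∑ y, (1 - (κ : ℂ) • S) (y.1.1, y.2) (x.1.1, x.2) *
      (1 : Matrix (Fin N → b) _ ℂ) x.1.2 y.1.2 * (portProgram N (U t) ⊗ₖ ρ) x y, ?_⟩
    ext p q
    rw [SuperOp.ofChoi_apply, Matrix.smul_apply, smul_eq_mul, mul_comm, Finset.mul_sum]
    refine Finset.sum_congr rfl fun x _ => ?_
    rw [Finset.mul_sum]
    exact Finset.sum_congr rfl fun y _ => mul_assoc _ _ _
  -- the total probability is one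
  have htot : (SuperOp.ofChoi (successChoi κ M) (portProgram N (U t) ⊗ₖ ρ)).trace +
      (SuperOp.ofChoi (failureChoi ρ₀ (1 - (κ : ℂ) • S)) (portProgram N (U t) ⊗ₖ ρ)).trace = 1 := by
    simp only [SuperOp.trace_ofChoi, ← Finset.sum_add_distrib, ← add_mul, ← Matrix.add_apply,
      hsum]
    refine Eq.trans ?_ hτρ.2
    simp [Matrix.trace]
  rw [hS, hc, Matrix.trace_smul, Matrix.trace_smul, ((hU t).isState hρ).2, hρ₀.2] at htot
  rw [hc]
  congr 1
  simp only [smul_eq_mul, mul_one] at htot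
  push_cast at htot
  linear_combination htot

end Program

theorem mainTheorem3 {a b : Type*} [Fintype a] [Fintype b]
    (ε : ℝ) (hε₀ : 0 < ε) (hε₁ : ε ≤ 1) (ρ₀ : Matrix b b ℂ) (hρ₀ : IsState ρ₀) :
    -- programmability, for an arbitrary family of channels
    (∀ {T : Type*} (U : T → SuperOp a b), (∀ t, IsChannel (U t)) →
      IsProgrammable (fun t => noisy ε ρ₀ (U t)) ∧ IsProgrammableWithFailure U ε ρ₀) ∧
    -- the standard quantum limit, for a family depending differentiably on a parameter `θ ∈ Θ`
    (∀ {V : Type*} [NormedAddCommGroup V] [NormedSpace ℝ V] [FiniteDimensional ℝ V]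
      [Nontrivial V] [MeasurableSpace V] [BorelSpace V] (μ : Measure V) [μ.IsAddHaarMeasure]
      (Θ : Set V) (U : V → SuperOp a b),
      (interior Θ).Nonempty →
      (∀ θ ∈ Θ, IsChannel (U θ)) →
      (∀ ρ, IsState ρ → ∀ i j, DifferentiableOn ℝ (fun θ => noisy ε ρ₀ (U θ) ρ i j) Θ) →
      (∃ c : ℝ, 0 < c ∧ ∀ N : ℕ, 0 < N → ∀ P : EstimationProtocol a b V N,
        ∃ θ ∈ Θ, c / √(N : ℝ) ≤ P.rmse (noisy ε ρ₀ (U θ)) θ) ∧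
      (∀ P : ∀ N : ℕ, EstimationProtocol a b V N, ∀ᵐ θ ∂μ, θ ∈ Θ →
        ¬ (fun N => (P N).rmse (noisy ε ρ₀ (U θ)) θ) =o[atTop]
          (fun N : ℕ => 1 / √(N : ℝ)))) := by
  refine ⟨fun U hU => ?_, ?_⟩
  · have h := isProgrammableWithFailure hε₀ hε₁ hρ₀ hU
    exact ⟨h.isProgrammable_noisy, h⟩
  · intro V _ _ _ _ _ _ μ _ Θ U hΘ hU hd
    exact ⟨exists_le_rmse μ hε₀ hε₁ hρ₀ hΘ hU hd, ae_not_isLittleO_rmse μ hε₀ hε₁ hρ₀ hU hd⟩
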